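/- Let $\mathcal L$ be a semilattice, that is, a partially ordered set in which any two elements $i,j$ have a greatest lower bound $i\wedge j$. A C*-algebra $\mathfrak A$ is said to be $\mathcal L$-graded with components $(A_i)_{i\in\mathcal L}$ if $(A_i)_{i\in\mathcal L}$ is a family of C*-subalgebras of $\mathfrak A$ that is linearly independent (a finitely supported sum $\sum_i a_i$ with $a_i\in A_i$ vanishes only if every $a_i=0$) and total ($\sum_i A_i$ is dense in $\mathfrak A$), and if $A_iA_j\subset A_{i\wedge j}$ for all $i,j\in\mathcal L$. Let $(\mathfrak A,(A_i)_{i\in\mathcal L})$ be an $\mathcal L$-graded C*-algebra, let $G$ be a locally compact (Hausdorff) group with left Haar measure $\mu$, and let $\alpha$ be a continuous action of $G$ on $\mathfrak A$, i.e. a homomorphism $g\mapsto\alpha_g$ from $G$ to the group of $*$-automorphisms of $\mathfrak A$ such that $g\mapsto\alpha_g(a)$ is continuous for every $a\in\mathfrak A$. Suppose that $\alpha_g(A_i)\subset A_i$ for all $g\in G$ and $i\in\mathcal L$. For a C*-algebra $B$ with a continuous action of $G$, let $B\rtimes_\alpha G$ (full crossed product) be the completion of the convolution $*$-algebra $C_c(G,B)$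 for the norm $\|f\|_u=\sup\|(\pi\times U)(f)\|$, the supremum being over all covariant representations $(\pi,U)$ of the system, where $(\pi\times U)(f)=\int_G\pi(f(s))U_s\,d\mu(s)$; and let $B\rtimes_{r,\alpha}G$ (reduced crossed product) be its completion for the norm given by the same supremum restricted to the left regular representations $(\tilde\rho,U)$ on $L^2(G,H)$, $(\tilde\rho(b)h)(r)=\rho(\alpha_r^{-1}(b))h(r)$, $(U_sh)(r)=h(s^{-1}r)$, associated with the representations $\rho$ of $B$ on Hilbert spaces $H$. Then for every $i\in\mathcal L$ the canonical morphisms $A_i\rtimes_\alpha G\to\mathfrak A\rtimes_\alpha G$ and $A_i\rtimes_{r,\alpha}G\to\mathfrak A\rtimes_{r,\alpha}G$ induced by the inclusion $A_i\subset\mathfrak A$ are injective, and, identifying $A_i\rtimes_\alpha G$ and $A_i\rtimes_{r,\alpha}G$ with their images, $\mathfrak A\rtimes_\alpha G$ is an $\mathcal L$-graded C*-algebra with components $(A_i\rtimes_\alpha G)_{i\in\mathcal L}$ and $\mathfrak A\rtimes_{r,\alpha}G$ is an $\mathcal L$-graded C*-algebra with components $(A_i\rtimes_{r,\alpha}G)_{i\in\mathcal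 L}$. -/

import Mathlib

open MeasureTheory Function
open scoped CompactlySupported

noncomputable section

set_option linter.unusedSectionVars false

namespace CrossedProduct

universe u v w

/-- A grading of the C⋆-algebra `A` by the semilattice `L`: a linearly independent and total family
of C⋆-subalgebras (norm-closed ⋆-subalgebras) such that `A i * A j ⊆ A (i ⊓ j)`. -/
structure IsCStarGrading {L : Type w} [SemilatticeInf L] {A : Type u} [NonUnitalCStarAlgebra A]
    (S : L → NonUnitalStarSubalgebra ℂ A) : Prop where
  isClosed : ∀ i, IsClosed (S i : Set A)
  independent : iSupIndep fun i => (S i).toNonUnitalSubalgebra.toSubmodule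
  total : Dense ((⨆ i, (S i).toNonUnitalSubalgebra.toSubmodule : Submodule ℂ A) : Set A)
  mul_mem : ∀ i j, ∀ a ∈ S i, ∀ b ∈ S j, a * b ∈ S (i ⊓ j)

/-- A C⋆-seminorm on an involutive complex algebra: a submultiplicative seminorm `p` with
`p (x⋆ x) = p x ^ 2`. -/
structure CStarSeminorm (R : Type u) [NonUnitalRing R] [StarRing R] [Module ℂ R] extends
    Seminorm ℂ R where
  mul_le' : ∀ x y, toFun (x * y) ≤ toFun x * toFun y
  star_mul_self' : ∀ x, toFun (star x * x) = toFun x * toFun x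

namespace CStarSeminorm

section

variable {R : Type u} [NonUnitalRing R] [StarRing R] [Module ℂ R]

/-- The algebra `R` regarded as seminormed by `p`. -/
def Pre (_p : CStarSeminorm R) : Type u := R

variable (p : CStarSeminorm R)

instance : NonUnitalRing p.Pre := inferInstanceAs (NonUnitalRing R)
instance : StarRing p.Pre := inferInstanceAs (StarRing R)
instance : Module ℂ p.Pre := inferInstanceAs (Module ℂ R)
instance [StarModule ℂ R] : StarModule ℂ p.Pre := inferInstanceAs (StarModule ℂ R)
instance [IsScalarTower ℂ R R] : IsScalarTower ℂ p.Pre p.Pre :=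
  inferInstanceAs (IsScalarTower ℂ R R)
instance [SMulCommClass ℂ R R] : SMulCommClass ℂ p.Pre p.Pre :=
  inferInstanceAs (SMulCommClass ℂ R R)

instance : NonUnitalSeminormedRing p.Pre where
  __ : NonUnitalRing p.Pre := inferInstance
  __ := (show SeminormedAddCommGroup R from
    AddGroupSeminorm.toSeminormedAddCommGroup p.toAddGroupSeminorm)
  norm_mul_le x y := p.mul_le' x y

theorem norm_def (x : p.Pre) : ‖x‖ = p.toFun x := rfl

instance : NormedSpace ℂ p.Pre where
  norm_smul_le c x := (p.smul' c x).le

theorem norm_star_mul_self_pre (x : p.Pre) : ‖star x * x‖ = ‖x‖ * ‖x‖ := p.star_mul_self' x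

instance : NormedStarGroup p.Pre where
  norm_star_le x := by
    have h := (p.norm_star_mul_self_pre (star x)).symm.le.trans (norm_mul_le _ _)
    rw [star_star] at h
    rcases (norm_nonneg (star x)).eq_or_lt with h0 | h0
    · rw [← h0]; exact norm_nonneg x
    · exact le_of_mul_le_mul_right h h0

/-- The Hausdorff completion of `R` with respect to the C⋆-seminorm `p`. -/
abbrev Completion : Type u := UniformSpace.Completion p.Pre

end

section

open UniformSpace.Completion

variable {R : Type u} [NonUnitalRing R] [StarRing R] [Module ℂ R] (p : CStarSeminorm R)

theorem isDenseInducing_prod :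
    IsDenseInducing (Prod.map ((↑) : p.Pre → p.Completion) ((↑) : p.Pre → p.Completion)) :=
  isDenseInducing_coe.prodMap isDenseInducing_coe

/-- Multiplication of the completion: the continuous extension of the product of `R`. -/
instance : Mul p.Completion :=
  ⟨curry <| p.isDenseInducing_prod.extend ((↑) ∘ uncurry (· * ·))⟩

/-- Involution of the completion: the continuous extension of the involution of `R`. -/
instance : Star p.Completion := ⟨UniformSpace.Completion.map star⟩

theorem coe_mul (x y : p.Pre) : ((x * y : p.Pre) : p.Completion) = x * y :=
  (p.isDenseInducing_prod.extend_eq ((continuous_coe p.Pre).comp continuous_mul) (x, y)).symm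

theorem uniformContinuous_star_pre : UniformContinuous (star : p.Pre → p.Pre) :=
  (LipschitzWith.of_dist_le_mul (K := 1) fun x y => by
    rw [dist_eq_norm, ← star_sub, norm_star, dist_eq_norm]; simp).uniformContinuous

theorem coe_star (x : p.Pre) : ((star x : p.Pre) : p.Completion) = star (x : p.Completion) :=
  (map_coe p.uniformContinuous_star_pre x).symm

instance : ContinuousMul p.Completion where
  continuous_mul := by
    let m := (AddMonoidHom.mul : p.Pre →+ p.Pre →+ p.Pre).compr₂ toCompl
    have : Continuous fun q : p.Pre × p.Pre => m q.1 q.2 :=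
      (continuous_coe p.Pre).comp continuous_mul
    have di : IsDenseInducing (toCompl : p.Pre → p.Completion) := isDenseInducing_coe
    exact (di.extend_Z_bilin di this :)

instance : ContinuousStar p.Completion := ⟨continuous_map⟩

instance : NonUnitalRing p.Completion :=
  { (inferInstance : AddCommGroup p.Completion), (inferInstance : Mul p.Completion) with
    zero_mul a := by
      induction a using UniformSpace.Completion.induction_on with
      | hp => exact isClosed_eq (by fun_prop) continuous_const
      | ih a => rw [← UniformSpace.Completion.coe_zero, ← coe_mul, zero_mul]
    mul_zero a := by
      induction a using UniformSpace.Completion.induction_on with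
      | hp => exact isClosed_eq (by fun_prop) continuous_const
      | ih a => rw [← UniformSpace.Completion.coe_zero, ← coe_mul, mul_zero]
    mul_assoc a b c := by
      induction a, b, c using UniformSpace.Completion.induction_on₃ with
      | hp => exact isClosed_eq (by fun_prop) (by fun_prop)
      | ih a b c => rw [← coe_mul, ← coe_mul, ← coe_mul, ← coe_mul, mul_assoc]
    left_distrib a b c := by
      induction a, b, c using UniformSpace.Completion.induction_on₃ with
      | hp => exact isClosed_eq (by fun_prop) (by fun_prop)
      | ih a b c => rw [← UniformSpace.Completion.coe_add, ← coe_mul, ← coe_mul, ← coe_mul,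
          ← UniformSpace.Completion.coe_add, mul_add]
    right_distrib a b c := by
      induction a, b, c using UniformSpace.Completion.induction_on₃ with
      | hp => exact isClosed_eq (by fun_prop) (by fun_prop)
      | ih a b c => rw [← UniformSpace.Completion.coe_add, ← coe_mul, ← coe_mul, ← coe_mul,
          ← UniformSpace.Completion.coe_add, add_mul] }

instance : NonUnitalNormedRing p.Completion where
  __ : NonUnitalRing p.Completion := inferInstance
  __ : NormedAddCommGroup p.Completion := inferInstance
  norm_mul_le x y := by
    induction x, y using UniformSpace.Completion.induction_on₂ with
    | hp => exact isClosed_le (by fun_prop) (by fun_prop)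
    | ih x y => simpa only [← coe_mul, norm_coe] using norm_mul_le x y

instance : StarRing p.Completion where
  star_involutive x := by
    induction x using UniformSpace.Completion.induction_on with
    | hp => exact isClosed_eq (by fun_prop) (by fun_prop)
    | ih x => rw [← coe_star, ← coe_star, star_star]
  star_mul x y := by
    induction x, y using UniformSpace.Completion.induction_on₂ with
    | hp => exact isClosed_eq (by fun_prop) (by fun_prop)
    | ih x y => rw [← coe_mul, ← coe_star, ← coe_star, ← coe_star, ← coe_mul, star_mul]
  star_add x y := by
    induction x, y using UniformSpace.Completion.induction_on₂ with
    | hp => exact isClosed_eq (by fun_prop) (by fun_prop)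
    | ih x y => rw [← UniformSpace.Completion.coe_add, ← coe_star, ← coe_star, ← coe_star,
        ← UniformSpace.Completion.coe_add, star_add]

/-- The completion of an involutive algebra for a C⋆-seminorm is a C⋆-algebra. -/
instance [IsScalarTower ℂ R R] [SMulCommClass ℂ R R] [StarModule ℂ R] :
    NonUnitalCStarAlgebra p.Completion where
  norm_mul_self_le x := by
    induction x using UniformSpace.Completion.induction_on with
    | hp => exact isClosed_le (by fun_prop) (by fun_prop)
    | ih x => rw [← coe_star, ← coe_mul, norm_coe, norm_coe, norm_star_mul_self_pre]
  smul_assoc c x y := by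
    induction x, y using UniformSpace.Completion.induction_on₂ with
    | hp =>
      exact isClosed_eq ((continuous_fst.const_smul c).mul continuous_snd)
        ((continuous_fst.mul continuous_snd).const_smul c)
    | ih x y =>
      simp only [smul_eq_mul]
      rw [← coe_smul, ← coe_mul, ← coe_mul, ← coe_smul, smul_mul_assoc]
  smul_comm c x y := by
    induction x, y using UniformSpace.Completion.induction_on₂ with
    | hp =>
      exact isClosed_eq ((continuous_fst.mul continuous_snd).const_smul c)
        (continuous_fst.mul (continuous_snd.const_smul c))
    | ih x y =>
      simp only [smul_eq_mul]
      rw [← coe_smul, ← coe_mul, ← coe_mul, ← coe_smul, mul_smul_comm]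
  star_smul c x := by
    induction x using UniformSpace.Completion.induction_on with
    | hp => exact isClosed_eq (continuous_id.const_smul c).star (continuous_star.const_smul (star c))
    | ih x => rw [← coe_smul, ← coe_star, ← coe_star, ← coe_smul, star_smul]

end

section

variable {R S : Type u} [NonUnitalRing R] [StarRing R] [Module ℂ R] [NonUnitalRing S] [StarRing S]
  [Module ℂ S]

/-- A ⋆-homomorphism, regarded as a map between seminormed algebras. -/
def preMap (p : CStarSeminorm R) (q : CStarSeminorm S) (φ : R →⋆ₙₐ[ℂ] S) : p.Pre →⋆ₙₐ[ℂ] q.Pre :=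
  φ

theorem uniformContinuous_preMap (p : CStarSeminorm R) (q : CStarSeminorm S) (φ : R →⋆ₙₐ[ℂ] S)
    (h : ∀ x, q.toFun (φ x) ≤ p.toFun x) : UniformContinuous (preMap p q φ) :=
  (LipschitzWith.of_dist_le_mul (K := 1) fun x y => by
    rw [dist_eq_norm, dist_eq_norm, ← map_sub, NNReal.coe_one, one_mul]
    exact h _).uniformContinuous

/-- A ⋆-homomorphism that does not increase the C⋆-seminorms extends by continuity to the
completions. -/
def mapCompletion (p : CStarSeminorm R) (q : CStarSeminorm S) (φ : R →⋆ₙₐ[ℂ] S)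
    (h : ∀ x, q.toFun (φ x) ≤ p.toFun x) : p.Completion →⋆ₙₐ[ℂ] q.Completion :=
  have hu := uniformContinuous_preMap p q φ h
  have hc : Continuous (UniformSpace.Completion.map (preMap p q φ)) :=
    UniformSpace.Completion.continuous_map
  have he (x : p.Pre) : UniformSpace.Completion.map (preMap p q φ) (x : p.Completion) =
      (preMap p q φ x : q.Completion) := UniformSpace.Completion.map_coe hu x
  { toFun := UniformSpace.Completion.map (preMap p q φ)
    map_zero' := by
      rw [← UniformSpace.Completion.coe_zero, he, map_zero, UniformSpace.Completion.coe_zero]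
    map_add' x y := by
      induction x, y using UniformSpace.Completion.induction_on₂ with
      | hp => exact isClosed_eq (by fun_prop) (by fun_prop)
      | ih x y =>
        rw [← UniformSpace.Completion.coe_add, he, he, he, map_add,
          UniformSpace.Completion.coe_add]
    map_mul' x y := by
      induction x, y using UniformSpace.Completion.induction_on₂ with
      | hp => exact isClosed_eq (by fun_prop) (by fun_prop)
      | ih x y => rw [← coe_mul, he, he, he, map_mul, coe_mul]
    map_smul' c x := by
      induction x using UniformSpace.Completion.induction_on with
      | hp => exact isClosed_eq (hc.comp (continuous_id.const_smul c)) (hc.const_smul c)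
      | ih x =>
        rw [MonoidHom.id_apply, ← UniformSpace.Completion.coe_smul, he, he, map_smul,
          UniformSpace.Completion.coe_smul]
    map_star' x := by
      induction x using UniformSpace.Completion.induction_on with
      | hp => exact isClosed_eq (by fun_prop) (by fun_prop)
      | ih x => rw [← coe_star, he, he, map_star, coe_star] }

end

end CStarSeminorm

/-- A continuous action of the topological group `G` on the C⋆-algebra `A`: a homomorphism from `G`
to the group of ⋆-automorphisms of `A` such that `g ↦ α g a` is continuous for every `a`. -/
structure CStarAction (G : Type v) [Group G] [TopologicalSpace G] (A : Type u)
    [NonUnitalCStarAlgebra A] where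
  aut : G →* (A ≃⋆ₐ[ℂ] A)
  continuous_orbit : ∀ a : A, Continuous fun g => aut g a

namespace CStarAction

variable {G : Type v} [Group G] [TopologicalSpace G] {A : Type u} [NonUnitalCStarAlgebra A]

instance : CoeFun (CStarAction G A) fun _ => G → A ≃⋆ₐ[ℂ] A := ⟨fun α => α.aut⟩

variable (α : CStarAction G A)

theorem mul_apply (g h : G) (a : A) : α (g * h) a = α g (α h a) := by
  rw [map_mul, StarAlgEquiv.mul_apply]

theorem one_apply (a : A) : α 1 a = a := by
  rw [map_one, StarAlgEquiv.one_apply]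

theorem inv_apply_self (g : G) (a : A) : α g⁻¹ (α g a) = a := by
  rw [← mul_apply, inv_mul_cancel, one_apply]

theorem self_inv_apply (g : G) (a : A) : α g (α g⁻¹ a) = a := by
  rw [← mul_apply, mul_inv_cancel, one_apply]

theorem norm_apply (g : G) (a : A) : ‖α g a‖ = ‖a‖ :=
  NonUnitalStarAlgHom.norm_map (α g) (α g).injective a

theorem continuous_uncurry : Continuous fun q : G × A => α q.1 q.2 := by
  rw [continuous_iff_continuousAt]
  rintro ⟨g₀, a₀⟩
  have h1 : Filter.Tendsto (fun q : G × A => α q.1 (q.2 - a₀)) (nhds (g₀, a₀)) (nhds 0) := by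
    rw [tendsto_zero_iff_norm_tendsto_zero]
    simp only [norm_apply]
    have : Continuous fun q : G × A => ‖q.2 - a₀‖ := by fun_prop
    simpa using this.tendsto (g₀, a₀)
  have h2 : Filter.Tendsto (fun q : G × A => α q.1 a₀) (nhds (g₀, a₀)) (nhds (α g₀ a₀)) :=
    ((α.continuous_orbit a₀).comp continuous_fst).tendsto (g₀, a₀)
  have := h1.add h2
  rw [zero_add] at this
  refine this.congr fun q => ?_
  rw [← map_add, sub_add_cancel]

theorem continuous_comp {X : Type*} [TopologicalSpace X] {p : X → G} {f : X → A}
    (hp : Continuous p) (hf : Continuous f) : Continuous fun x => α (p x) (f x) :=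
  α.continuous_uncurry.comp (hp.prodMk hf)

/-- The ⋆-automorphism `α g` as a continuous linear map. -/
def clm (g : G) : A →L[ℂ] A :=
  LinearMap.mkContinuous
    { toFun := α g, map_add' := map_add (α g), map_smul' := map_smul (α g) } 1
    fun a => by simp [norm_apply]

theorem clm_apply (g : G) (a : A) : α.clm g a = α g a := rfl

/-- The restriction of a continuous action to an invariant C⋆-subalgebra. -/
def restrict (S : NonUnitalStarSubalgebra ℂ A) [IsClosed (S : Set A)]
    (hS : ∀ g, ∀ a ∈ S, α g a ∈ S) : CStarAction G S where
  aut :=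
    { toFun := fun g =>
        { toFun := fun a => ⟨α g a, hS g a a.2⟩
          invFun := fun a => ⟨α g⁻¹ a, hS g⁻¹ a a.2⟩
          left_inv := fun a => Subtype.ext (α.inv_apply_self g a)
          right_inv := fun a => Subtype.ext (α.self_inv_apply g a)
          map_mul' := fun a b => Subtype.ext (map_mul (α g) (a : A) b)
          map_add' := fun a b => Subtype.ext (map_add (α g) (a : A) b)
          map_star' := fun a => Subtype.ext (map_star (α g) (a : A))
          map_smul' := fun c a => Subtype.ext (map_smul (α g) c (a : A)) }
      map_one' := StarAlgEquiv.ext fun a => Subtype.ext (α.one_apply a)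
      map_mul' := fun g h => StarAlgEquiv.ext fun a => Subtype.ext (α.mul_apply g h a) }
  continuous_orbit a := (α.continuous_orbit a).subtype_mk _

end CStarAction

section Modular

variable {G : Type v} [Group G] [TopologicalSpace G] [IsTopologicalGroup G] [LocallyCompactSpace G]

/-- The modular function `Δ` of `G`, normalized by `Δ r * ∫ h (s * r) ds = ∫ h s ds` for the left
Haar measure `ds`; in Mathlib's normalization this is the modular character at `r⁻¹`. -/
def modularFunction (r : G) : ℝ := Measure.modularCharacter r⁻¹

theorem modularFunction_mul (r s : G) :
    modularFunction (r * s) = modularFunction r * modularFunction s := by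
  simp only [modularFunction, mul_inv_rev, map_mul, NNReal.coe_mul]
  exact mul_comm _ _

theorem modularFunction_one : modularFunction (1 : G) = 1 := by
  simp [modularFunction]

theorem integral_mul_right_eq [MeasurableSpace G] [BorelSpace G] (μ : Measure G) [μ.IsHaarMeasure]
    {h : G → ℝ} (hc : Continuous h) (hs : HasCompactSupport h) (r : G) :
    ∫ s, h (s * r) ∂μ = modularFunction r⁻¹ * ∫ s, h s ∂μ := by
  have h1 := Measure.integral_isMulLeftInvariant_eq_smul_of_hasCompactSupport
    (μ.map (· * r)) μ hc hs
  rw [integral_map (by fun_prop) hc.aestronglyMeasurable, integral_smul_nnreal_measure,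
    ← Measure.modularCharacterFun_eq_haarScalarFactor] at h1
  rw [h1, modularFunction, inv_inv]
  rfl

theorem modularFunction_mul_integral [MeasurableSpace G] [BorelSpace G] (μ : Measure G)
    [μ.IsHaarMeasure] {h : G → ℝ} (hc : Continuous h) (hs : HasCompactSupport h) (r : G) :
    modularFunction r * ∫ s, h (s * r) ∂μ = ∫ s, h s ∂μ := by
  rw [integral_mul_right_eq μ hc hs, ← mul_assoc, ← modularFunction_mul, mul_inv_cancel,
    modularFunction_one, one_mul]

theorem continuous_modularFunction : Continuous (modularFunction : G → ℝ) := by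
  borelize G
  let μ : Measure G := Measure.haar
  obtain ⟨⟨h, hc⟩, hs, h0, h1⟩ : ∃ h : C(G, ℝ), HasCompactSupport h ∧ 0 ≤ h ∧ h 1 ≠ 0 :=
    exists_continuous_nonneg_pos 1
  have hne : ∫ s, h s ∂μ ≠ 0 :=
    (hc.integral_pos_of_hasCompactSupport_nonneg_nonzero hs h0 h1).ne'
  have key : ∀ r, modularFunction r = (∫ s, h (s * r⁻¹) ∂μ) / ∫ s, h s ∂μ := fun r => by
    rw [integral_mul_right_eq μ hc hs, inv_inv, mul_div_cancel_right₀ _ hne]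
  have hcont : Continuous fun r => ∫ s, h (s * r⁻¹) ∂μ := by
    refine continuous_iff_continuousAt.2 fun r₀ => ?_
    obtain ⟨t, t_comp, ht⟩ : ∃ t, IsCompact t ∧ t ∈ nhds r₀ := exists_compact_mem_nhds r₀
    have hK : IsCompact ((fun q : G × G => q.1 * q.2) '' (tsupport h ×ˢ t)) :=
      (hs.isCompact.prod t_comp).image continuous_mul
    refine ContinuousOn.continuousAt (s := t) ?_ ht
    refine continuousOn_integral_of_compact_support hK ?_ ?_
    · exact (hc.comp (continuous_snd.mul continuous_fst.inv)).continuousOn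
    · intro r s hr hsK
      contrapose! hsK
      exact ⟨(s * r⁻¹, r), ⟨subset_tsupport _ hsK, hr⟩, by simp⟩
  rw [show (modularFunction : G → ℝ) = _ from funext key]
  exact hcont.div_const _

theorem integral_inv_modular [MeasurableSpace G] [BorelSpace G] (μ : Measure G)
    [μ.IsHaarMeasure] {E : Type*} [NormedAddCommGroup E] [NormedSpace ℝ E] [CompleteSpace E]
    {f : G → E} (hf : Continuous f) (hfs : HasCompactSupport f) :
    ∫ s, modularFunction s⁻¹ • f s⁻¹ ∂μ = ∫ s, f s ∂μ := by
  obtain ⟨⟨g, hg⟩, hgs, g0, g1⟩ : ∃ h : C(G, ℝ), HasCompactSupport h ∧ 0 ≤ h ∧ h 1 ≠ 0 :=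
    exists_continuous_nonneg_pos 1
  simp only [ContinuousMap.coe_mk] at hgs g1
  have hne : ∫ s, g s ∂μ ≠ 0 :=
    (hg.integral_pos_of_hasCompactSupport_nonneg_nonzero hgs g0 g1).ne'
  have hfK : IsCompact (tsupport f) := hfs
  have hgK : IsCompact (tsupport g) := hgs
  have sw1 : ∫ s, ∫ t, g (t * s) • f s⁻¹ ∂μ ∂μ = ∫ t, ∫ s, g (t * s) • f s⁻¹ ∂μ ∂μ := by
    refine integral_integral_swap_of_hasCompactSupport (by fun_prop) ?_
    refine HasCompactSupport.intro ((hfK.prod hgK).image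
      (f := fun q : G × G => (q.1⁻¹, q.2 * q.1)) (by fun_prop)) ?_
    rintro ⟨s, t⟩ hst
    by_contra hne
    obtain ⟨h1, h2⟩ := smul_ne_zero_iff.1 hne
    exact hst ⟨(s⁻¹, t * s), ⟨subset_tsupport _ h2, subset_tsupport _ h1⟩, by simp⟩
  have sw2 : ∫ t, ∫ s, g s • f (s⁻¹ * t) ∂μ ∂μ = ∫ s, ∫ t, g s • f (s⁻¹ * t) ∂μ ∂μ := by
    refine integral_integral_swap_of_hasCompactSupport (by fun_prop) ?_
    refine HasCompactSupport.intro ((hgK.prod hfK).image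
      (f := fun q : G × G => (q.1 * q.2, q.1)) (by fun_prop)) ?_
    rintro ⟨t, s⟩ hst
    by_contra hne
    obtain ⟨h1, h2⟩ := smul_ne_zero_iff.1 hne
    exact hst ⟨(s, s⁻¹ * t), ⟨subset_tsupport _ h1, subset_tsupport _ h2⟩, by simp⟩
  have e1 : ∫ s, ∫ t, g (t * s) • f s⁻¹ ∂μ ∂μ =
      (∫ s, g s ∂μ) • ∫ s, modularFunction s⁻¹ • f s⁻¹ ∂μ := by
    rw [← integral_smul]
    refine integral_congr_ae (.of_forall fun s => ?_)
    simp only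
    rw [integral_smul_const, integral_mul_right_eq μ hg hgs, smul_smul, mul_comm]
  have e2 : ∫ t, ∫ s, g (t * s) • f s⁻¹ ∂μ ∂μ = ∫ t, ∫ s, g s • f (s⁻¹ * t) ∂μ ∂μ := by
    refine integral_congr_ae (.of_forall fun t => ?_)
    simp only
    rw [← integral_mul_left_eq_self (fun s => g s • f (s⁻¹ * t)) t]
    simp
  have e3 : ∫ s, ∫ t, g s • f (s⁻¹ * t) ∂μ ∂μ = (∫ s, g s ∂μ) • ∫ s, f s ∂μ := by
    rw [← integral_smul_const]
    refine integral_congr_ae (.of_forall fun s => ?_)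
    simp only
    rw [integral_smul, integral_mul_left_eq_self f s⁻¹]
  have := e1.symm.trans (sw1.trans (e2.trans (sw2.trans e3)))
  exact smul_right_injective E hne this

end Modular

section ConvAlg

variable {G : Type v} [Group G] [TopologicalSpace G] {A : Type u} [NonUnitalCStarAlgebra A]

/-- The space `C_c(G, A)`, which carries below the involutive algebra structure (convolution product
and twisted involution) defined by the action `α` and the left Haar measure `μ`. -/
def ConvAlg [MeasurableSpace G] (_α : CStarAction G A) (_μ : Measure G) : Type (max u v) := C_c(G, A)

namespace ConvAlg

variable [MeasurableSpace G] {α : CStarAction G A} {μ : Measure G}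

instance : FunLike (ConvAlg α μ) G A := inferInstanceAs (FunLike C_c(G, A) G A)
instance : AddCommGroup (ConvAlg α μ) := inferInstanceAs (AddCommGroup C_c(G, A))
instance : Module ℂ (ConvAlg α μ) := inferInstanceAs (Module ℂ C_c(G, A))

theorem ext {f g : ConvAlg α μ} (h : ∀ s, f s = g s) : f = g := DFunLike.ext _ _ h

theorem continuous (f : ConvAlg α μ) : Continuous f := map_continuous (show C_c(G, A) from f)

theorem isCompact_tsupport (f : ConvAlg α μ) : IsCompact (tsupport f) :=
  CompactlySupportedContinuousMap.hasCompactSupport (show C_c(G, A) from f)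

theorem add_apply (f g : ConvAlg α μ) (s : G) : (f + g) s = f s + g s := rfl
theorem zero_apply (s : G) : (0 : ConvAlg α μ) s = 0 := rfl
theorem smul_apply (c : ℂ) (f : ConvAlg α μ) (s : G) : (c • f) s = c • f s := rfl

/-- An element of `C_c(G, A)` from a continuous function with compact support. -/
def mk (f : G → A) (hf : Continuous f) (hs : HasCompactSupport f) : ConvAlg α μ :=
  (⟨⟨f, hf⟩, hs⟩ : C_c(G, A))

theorem eq_zero_of_notMem {f : ConvAlg α μ} {s : G} (h : s ∉ tsupport f) : f s = 0 :=
  image_eq_zero_of_notMem_tsupport h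

variable [IsTopologicalGroup G] [LocallyCompactSpace G] [BorelSpace G] [μ.IsHaarMeasure]


theorem continuous_convIntegrand (f g : ConvAlg α μ) :
    Continuous fun q : G × G => f q.2 * α q.2 (g (q.2⁻¹ * q.1)) :=
  (f.continuous.comp continuous_snd).mul
    (α.continuous_comp continuous_snd (g.continuous.comp (by fun_prop)))

theorem convIntegrand_eq_zero (f g : ConvAlg α μ) (s : G) {r : G} (hr : r ∉ tsupport f) :
    f r * α r (g (r⁻¹ * s)) = 0 := by
  rw [eq_zero_of_notMem hr, zero_mul]

theorem integrable_convIntegrand (f g : ConvAlg α μ) (s : G) :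
    Integrable (fun r => f r * α r (g (r⁻¹ * s))) μ :=
  (f.continuous_convIntegrand g |>.comp (Continuous.prodMk_right s)).integrable_of_hasCompactSupport
    (HasCompactSupport.intro f.isCompact_tsupport fun _ hr => f.convIntegrand_eq_zero g s hr)

/-- The convolution product `(f * g) s = ∫ f r * α r (g (r⁻¹ s)) dr`. -/
instance : Mul (ConvAlg α μ) where
  mul f g := mk (fun s => ∫ r, f r * α r (g (r⁻¹ * s)) ∂μ)
    (continuousOn_univ.1 <| continuousOn_integral_of_compact_support f.isCompact_tsupport
      (f.continuous_convIntegrand g).continuousOn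
      fun s _ _ hr => f.convIntegrand_eq_zero g s hr)
    (HasCompactSupport.intro ((f.isCompact_tsupport.prod g.isCompact_tsupport).image
        continuous_mul) fun s hs => by
      rw [← integral_zero G A (μ := μ)]
      refine integral_congr_ae (.of_forall fun r => ?_)
      simp only
      by_cases hr : r ∈ tsupport f
      · rw [eq_zero_of_notMem (f := g) (s := r⁻¹ * s), map_zero, mul_zero]
        exact fun hg => hs ⟨(r, r⁻¹ * s), ⟨hr, hg⟩, by simp⟩
      · exact f.convIntegrand_eq_zero g s hr)

theorem mul_apply (f g : ConvAlg α μ) (s : G) :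
    (f * g) s = ∫ r, f r * α r (g (r⁻¹ * s)) ∂μ := rfl

/-- The involution `f⋆ s = Δ(s⁻¹) α s (f(s⁻¹)⋆)`. -/
instance : Star (ConvAlg α μ) where
  star f := mk (fun s => (modularFunction s⁻¹ : ℂ) • α s (star (f s⁻¹)))
    ((Complex.continuous_ofReal.comp (continuous_modularFunction.comp continuous_inv)).smul
      (α.continuous_comp continuous_id (f.continuous.comp continuous_inv).star))
    (HasCompactSupport.intro f.isCompact_tsupport.inv fun s hs => by
      rw [eq_zero_of_notMem (f := f) (s := s⁻¹) hs, star_zero, map_zero, smul_zero])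

theorem star_apply (f : ConvAlg α μ) (s : G) :
    star f s = (modularFunction s⁻¹ : ℂ) • α s (star (f s⁻¹)) := rfl

theorem mul_assoc_aux (f g h : ConvAlg α μ) : f * g * h = f * (g * h) := by
  refine ext fun s => ?_
  have hL : (f * g * h) s =
      ∫ r, ∫ t, f t * α t (g (t⁻¹ * r)) * α r (h (r⁻¹ * s)) ∂μ ∂μ := by
    rw [mul_apply]
    refine integral_congr_ae (.of_forall fun r => ?_)
    exact (((ContinuousLinearMap.mul ℂ A).flip (α r (h (r⁻¹ * s)))).integral_comp_comm
      (f.integrable_convIntegrand g r)).symm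
  have hR : (f * (g * h)) s =
      ∫ t, ∫ r, f t * α t (g (t⁻¹ * r)) * α r (h (r⁻¹ * s)) ∂μ ∂μ := by
    rw [mul_apply]
    refine integral_congr_ae (.of_forall fun t => ?_)
    have h1 : f t * α t ((g * h) (t⁻¹ * s)) =
        ∫ r, f t * α t (g r * α r (h (r⁻¹ * (t⁻¹ * s)))) ∂μ :=
      (((ContinuousLinearMap.mul ℂ A (f t)).comp (α.clm t)).integral_comp_comm
        (g.integrable_convIntegrand h (t⁻¹ * s))).symm
    simp only
    rw [h1, ← integral_mul_left_eq_self _ t⁻¹]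
    refine integral_congr_ae (.of_forall fun r => ?_)
    simp only
    rw [map_mul, ← α.mul_apply, mul_assoc]
    simp [mul_assoc]
  rw [hL, hR]
  have hc : Continuous fun q : G × G =>
      f q.2 * α q.2 (g (q.2⁻¹ * q.1)) * α q.1 (h (q.1⁻¹ * s)) :=
    (f.continuous_convIntegrand g).mul
      (α.continuous_comp continuous_fst (h.continuous.comp (by fun_prop)))
  refine integral_integral_swap_of_hasCompactSupport hc ?_
  refine HasCompactSupport.intro ((f.isCompact_tsupport.prod g.isCompact_tsupport).image
    (f := fun q : G × G => (q.1 * q.2, q.1)) (by fun_prop)) ?_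
  rintro ⟨r, t⟩ hrt
  simp only [uncurry_apply_pair]
  by_cases ht : t ∈ tsupport f
  · rw [eq_zero_of_notMem (f := g) (s := t⁻¹ * r), map_zero, mul_zero, zero_mul]
    exact fun hg => hrt ⟨(t, t⁻¹ * r), ⟨ht, hg⟩, by simp⟩
  · rw [eq_zero_of_notMem ht, zero_mul, zero_mul]

instance : NonUnitalRing (ConvAlg α μ) where
  left_distrib f g h := ext fun s => by
    rw [add_apply, mul_apply, mul_apply, mul_apply,
      ← integral_add (f.integrable_convIntegrand g s) (f.integrable_convIntegrand h s)]
    simp only [add_apply, map_add, mul_add]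
  right_distrib f g h := ext fun s => by
    rw [add_apply, mul_apply, mul_apply, mul_apply,
      ← integral_add (f.integrable_convIntegrand h s) (g.integrable_convIntegrand h s)]
    simp only [add_apply, add_mul]
  zero_mul f := ext fun s => by simp [mul_apply, zero_apply]
  mul_zero f := ext fun s => by simp [mul_apply, zero_apply]
  mul_assoc := mul_assoc_aux

instance : IsScalarTower ℂ (ConvAlg α μ) (ConvAlg α μ) where
  smul_assoc c f g := ext fun s => by
    simp only [smul_eq_mul]
    rw [smul_apply, mul_apply, mul_apply, ← integral_smul]
    simp only [smul_apply, smul_mul_assoc]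

instance : SMulCommClass ℂ (ConvAlg α μ) (ConvAlg α μ) where
  smul_comm c f g := ext fun s => by
    simp only [smul_eq_mul]
    rw [smul_apply, mul_apply, mul_apply, ← integral_smul]
    simp only [smul_apply, map_smul, mul_smul_comm]

instance : StarRing (ConvAlg α μ) where
  star_involutive f := ext fun s => by
    rw [star_apply, star_apply, star_smul, map_smul, ← map_star, star_star, inv_inv,
      α.self_inv_apply, smul_smul]
    have : modularFunction s⁻¹ * modularFunction s = 1 := by
      rw [← modularFunction_mul, inv_mul_cancel, modularFunction_one]
    simp only [Complex.star_def, Complex.conj_ofReal]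
    rw [← Complex.ofReal_mul, this, Complex.ofReal_one, one_smul]
  star_add f g := ext fun s => by
    simp only [star_apply, add_apply, star_add, map_add, smul_add]
  star_mul f g := ext fun s => by
    rw [star_apply, mul_apply, mul_apply]
    have h1 : α s (star (∫ r, f r * α r (g (r⁻¹ * s⁻¹)) ∂μ)) =
        ∫ r, α s (star (f r * α r (g (r⁻¹ * s⁻¹)))) ∂μ :=
      ((((α.clm s).restrictScalars ℝ).comp
        ((starL' ℝ : A ≃L[ℝ] A) : A →L[ℝ] A)).integral_comp_comm
        (f.integrable_convIntegrand g s⁻¹)).symm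
    rw [h1, ← integral_smul, ← integral_mul_left_eq_self _ s⁻¹]
    refine integral_congr_ae (.of_forall fun r => ?_)
    simp only [star_apply]
    have h2 : modularFunction s⁻¹ = modularFunction r⁻¹ * modularFunction (r⁻¹ * s)⁻¹ := by
      rw [mul_comm, ← modularFunction_mul]; simp
    rw [h2]
    have h3 : ∀ (t : G) (a : A), α t ((α t)⁻¹ a) = a := fun t a => by
      rw [← map_inv, α.self_inv_apply]
    simp only [star_mul, map_mul, map_smul, ← map_star, smul_mul_assoc, mul_smul_comm, smul_smul,
      Complex.ofReal_mul]
    rw [mul_comm (modularFunction r⁻¹ : ℂ)]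
    simp [h3]

instance : StarModule ℂ (ConvAlg α μ) where
  star_smul c f := ext fun s => by
    simp only [star_apply, smul_apply, star_smul, map_smul]
    rw [smul_comm]

end ConvAlg

end ConvAlg

/-- The C⋆-seminorm `x ↦ sup ‖φ i x‖` defined by a pointwise bounded family of ⋆-homomorphisms into
C⋆-algebras. -/
def CStarSeminorm.ofFamily {R : Type u} [NonUnitalRing R] [StarRing R] [Module ℂ R]
    {ι : Type*} [Nonempty ι] {B : ι → Type*} [∀ i, CStarAlgebra (B i)] (φ : ∀ i, R →⋆ₙₐ[ℂ] B i)
    (bdd : ∀ x, BddAbove (Set.range fun i => ‖φ i x‖)) : CStarSeminorm R where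
  toFun x := ⨆ i, ‖φ i x‖
  map_zero' := by simp
  add_le' x y := ciSup_le fun i => by
    rw [map_add]
    exact (norm_add_le _ _).trans (add_le_add (le_ciSup (bdd x) i) (le_ciSup (bdd y) i))
  neg' x := by simp
  smul' c x := by
    simp only [map_smul, norm_smul]
    exact (Real.mul_iSup_of_nonneg (norm_nonneg c) _).symm
  mul_le' x y := ciSup_le fun i => by
    rw [map_mul]
    exact (norm_mul_le _ _).trans (mul_le_mul (le_ciSup (bdd x) i) (le_ciSup (bdd y) i)
      (norm_nonneg _) (Real.iSup_nonneg fun i => norm_nonneg _))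
  star_mul_self' x := by
    have h0 : 0 ≤ ⨆ i, ‖φ i x‖ := Real.iSup_nonneg fun i => norm_nonneg _
    have h1 : ∀ i, ‖φ i (star x * x)‖ = ‖φ i x‖ * ‖φ i x‖ := fun i => by
      rw [map_mul, map_star, CStarRing.norm_star_mul_self]
    refine le_antisymm (ciSup_le fun i => ?_) ?_
    · rw [h1]
      exact mul_self_le_mul_self (norm_nonneg _) (le_ciSup (bdd x) i)
    · have hb : BddAbove (Set.range fun i => ‖φ i (star x * x)‖) := bdd _
      have h2 : ⨆ i, ‖φ i x‖ ≤ √(⨆ i, ‖φ i (star x * x)‖) := ciSup_le fun i =>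
        Real.le_sqrt_of_sq_le (by rw [sq, ← h1]; exact le_ciSup hb i)
      refine (mul_self_le_mul_self h0 h2).trans_eq (Real.mul_self_sqrt ?_)
      exact Real.iSup_nonneg fun i => norm_nonneg _

/-- A (possibly degenerate) representation of the C⋆-algebra `A` on a Hilbert space. -/
structure HilbertRep (A : Type u) [NonUnitalCStarAlgebra A] where
  H : Type w
  [instNormed : NormedAddCommGroup H]
  [instInner : InnerProductSpace ℂ H]
  [instComplete : CompleteSpace H]
  π : A →⋆ₙₐ[ℂ] (H →L[ℂ] H)

attribute [instance] HilbertRep.instNormed HilbertRep.instInner HilbertRep.instComplete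

namespace HilbertRep

variable {A B : Type u} [NonUnitalCStarAlgebra A] [NonUnitalCStarAlgebra B]

theorem continuous_π (ρ : HilbertRep.{u, w} A) : Continuous ρ.π :=
  AddMonoidHomClass.continuous_of_bound ρ.π 1
    fun a => by simpa using NonUnitalStarAlgHom.norm_apply_le ρ.π a

/-- The representation as a continuous linear map. -/
def clm (ρ : HilbertRep.{u, w} A) : A →L[ℂ] (ρ.H →L[ℂ] ρ.H) where
  toFun := ρ.π
  map_add' := map_add ρ.π
  map_smul' := map_smul ρ.π
  cont := ρ.continuous_π

instance : Nonempty (HilbertRep.{u, w} A) := ⟨{ H := PUnit, π := 0 }⟩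

/-- The pull-back of a representation along a morphism of C⋆-algebras. -/
abbrev comp (ρ : HilbertRep.{u, w} B) (φ : A →⋆ₙₐ[ℂ] B) : HilbertRep.{u, w} A where
  H := ρ.H
  π := ρ.π.comp φ

end HilbertRep

/-- A covariant representation `(π, U)` of the C⋆-dynamical system `(A, G, α)`: a representation
`π` of `A` and a strongly continuous unitary representation `U` of `G` on the same Hilbert space
with `π (α s a) = U s * π a * (U s)⋆`. -/
structure CovariantRep {G : Type v} [Group G] [TopologicalSpace G] {A : Type u}
    [NonUnitalCStarAlgebra A] (α : CStarAction G A) extends HilbertRep.{u, max u v} A where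
  U : G →* unitary (H →L[ℂ] H)
  continuous_U : ∀ h : H, Continuous fun s => (U s : H →L[ℂ] H) h
  covariant : ∀ (s : G) (a : A),
    π (α s a) = (U s : H →L[ℂ] H) * π a * star (U s : H →L[ℂ] H)

namespace CovariantRep

variable {G : Type v} [Group G] [TopologicalSpace G] {A B : Type u} [NonUnitalCStarAlgebra A]
  [NonUnitalCStarAlgebra B] {α : CStarAction G A} {β : CStarAction G B}

instance : Nonempty (CovariantRep α) :=
  ⟨{ H := PUnit, π := 0, U := 1, continuous_U := fun _ => continuous_const
     covariant := fun _ _ => by simp }⟩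

/-- The pull-back of a covariant representation along an equivariant morphism. -/
def comp (R : CovariantRep β) (φ : A →⋆ₙₐ[ℂ] B) (hφ : ∀ s a, φ (α s a) = β s (φ a)) :
    CovariantRep α where
  toHilbertRep := R.toHilbertRep.comp φ
  U := R.U
  continuous_U := R.continuous_U
  covariant s a := (congrArg R.π (hφ s a)).trans (R.covariant s (φ a))

theorem covariant_apply (R : CovariantRep α) (s : G) (a : A) (h : R.H) :
    R.π (α s a) ((R.U s : R.H →L[ℂ] R.H) h) = (R.U s : R.H →L[ℂ] R.H) (R.π a h) := by
  have h1 : star (R.U s : R.H →L[ℂ] R.H) * (R.U s : R.H →L[ℂ] R.H) = 1 :=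
    Unitary.coe_star_mul_self (R.U s)
  rw [R.covariant, ← mul_apply_eq_comp, mul_assoc, h1, mul_one,
    mul_apply_eq_comp]

theorem U_mul_apply (R : CovariantRep α) (s t : G) (h : R.H) :
    (R.U (s * t) : R.H →L[ℂ] R.H) h =
      (R.U s : R.H →L[ℂ] R.H) ((R.U t : R.H →L[ℂ] R.H) h) := by
  rw [map_mul]; rfl

theorem norm_U_apply (R : CovariantRep α) (s : G) (h : R.H) :
    ‖(R.U s : R.H →L[ℂ] R.H) h‖ = ‖h‖ :=
  (Unitary.linearIsometryEquiv (R.U s)).norm_map h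

theorem inner_U_apply (R : CovariantRep α) (s : G) (h k : R.H) :
    inner ℂ h ((R.U s⁻¹ : R.H →L[ℂ] R.H) k) = inner ℂ ((R.U s : R.H →L[ℂ] R.H) h) k := by
  have h1 : (R.U s : R.H →L[ℂ] R.H) ((R.U s⁻¹ : R.H →L[ℂ] R.H) k) = k := by
    rw [← U_mul_apply, mul_inv_cancel, map_one]; rfl
  conv_rhs => rw [← h1]
  exact ((Unitary.linearIsometryEquiv (R.U s)).inner_map_map h _).symm

theorem continuous_U_uncurry (R : CovariantRep α) {X : Type*} [TopologicalSpace X] {p : X → G}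
    {f : X → R.H} (hp : Continuous p) (hf : Continuous f) :
    Continuous fun x => (R.U (p x) : R.H →L[ℂ] R.H) (f x) := by
  rw [continuous_iff_continuousAt]
  intro x₀
  have h1 : Filter.Tendsto (fun x => (R.U (p x) : R.H →L[ℂ] R.H) (f x - f x₀)) (nhds x₀)
      (nhds 0) := by
    rw [tendsto_zero_iff_norm_tendsto_zero]
    simp only [norm_U_apply]
    have : Continuous fun x => ‖f x - f x₀‖ := by fun_prop
    simpa using this.tendsto x₀
  have h2 := ((R.continuous_U (f x₀)).comp hp).tendsto x₀
  have := h1.add h2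
  rw [zero_add] at this
  refine this.congr fun q => ?_
  simp [map_sub]

variable [MeasurableSpace G] (R : CovariantRep α) {μ : Measure G}

theorem continuous_integrand (f : ConvAlg α μ) (h : R.H) :
    Continuous fun s => R.π (f s) ((R.U s : R.H →L[ℂ] R.H) h) :=
  (R.continuous_π.comp f.continuous).clm_apply (R.continuous_U h)

theorem integrand_eq_zero (f : ConvAlg α μ) (h : R.H) {s : G} (hs : s ∉ tsupport f) :
    R.π (f s) ((R.U s : R.H →L[ℂ] R.H) h) = 0 := by
  rw [ConvAlg.eq_zero_of_notMem hs, map_zero, _root_.zero_apply]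

variable [IsTopologicalGroup G] [LocallyCompactSpace G] [BorelSpace G] [μ.IsHaarMeasure]

theorem integrable_integrand (f : ConvAlg α μ) (h : R.H) :
    Integrable (fun s => R.π (f s) ((R.U s : R.H →L[ℂ] R.H) h)) μ :=
  (R.continuous_integrand f h).integrable_of_hasCompactSupport
    (HasCompactSupport.intro f.isCompact_tsupport fun _ hs => R.integrand_eq_zero f h hs)

theorem norm_integral_le (f : ConvAlg α μ) (h : R.H) :
    ‖∫ s, R.π (f s) ((R.U s : R.H →L[ℂ] R.H) h) ∂μ‖ ≤ (∫ s, ‖f s‖ ∂μ) * ‖h‖ := by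
  rw [← integral_mul_const]
  refine norm_integral_le_of_norm_le ?_ (.of_forall fun s => ?_)
  · exact ((f.continuous.norm).integrable_of_hasCompactSupport
      (HasCompactSupport.intro f.isCompact_tsupport fun _ hs => by
        rw [ConvAlg.eq_zero_of_notMem hs, norm_zero])).mul_const _
  · refine ((R.π (f s)).le_opNorm _).trans ?_
    rw [norm_U_apply]
    exact mul_le_mul_of_nonneg_right (NonUnitalStarAlgHom.norm_apply_le R.π (f s)) (norm_nonneg h)

/-- The operator `(π × U) f = ∫ π (f s) U s ds`; the integral converges in the strong operator
topology, that is, `(π × U) f h = ∫ π (f s) (U s h) ds` for every vector `h`. -/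
def integratedOp (f : ConvAlg α μ) : R.H →L[ℂ] R.H :=
  LinearMap.mkContinuous
    { toFun := fun h => ∫ s, R.π (f s) ((R.U s : R.H →L[ℂ] R.H) h) ∂μ
      map_add' := fun h k => by
        rw [← integral_add (R.integrable_integrand f h) (R.integrable_integrand f k)]
        simp only [map_add]
      map_smul' := fun c h => by
        rw [RingHom.id_apply, ← integral_smul]
        simp only [map_smul] }
    (∫ s, ‖f s‖ ∂μ) (R.norm_integral_le f)

theorem integratedOp_apply (f : ConvAlg α μ) (h : R.H) :
    R.integratedOp f h = ∫ s, R.π (f s) ((R.U s : R.H →L[ℂ] R.H) h) ∂μ := rfl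

theorem norm_integratedOp_le (f : ConvAlg α μ) : ‖R.integratedOp f‖ ≤ ∫ s, ‖f s‖ ∂μ :=
  LinearMap.mkContinuous_norm_le _ (integral_nonneg fun _ => norm_nonneg _) _

theorem integratedOp_mul (f g : ConvAlg α μ) :
    R.integratedOp (f * g) = R.integratedOp f * R.integratedOp g := by
  ext h
  rw [mul_apply_eq_comp, integratedOp_apply, integratedOp_apply]
  have hL : ∀ s, R.π ((f * g) s) ((R.U s : R.H →L[ℂ] R.H) h) =
      ∫ r, R.π (f r * α r (g (r⁻¹ * s))) ((R.U s : R.H →L[ℂ] R.H) h) ∂μ := fun s =>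
    ((((ContinuousLinearMap.apply ℂ R.H ((R.U s : R.H →L[ℂ] R.H) h))).comp
      R.clm).integral_comp_comm
      (f.integrable_convIntegrand g s)).symm
  have hR : ∀ r, R.π (f r) ((R.U r : R.H →L[ℂ] R.H) (R.integratedOp g h)) =
      ∫ s, R.π (f r * α r (g (r⁻¹ * s))) ((R.U s : R.H →L[ℂ] R.H) h) ∂μ := fun r => by
    rw [integratedOp_apply]
    have := (((R.π (f r)).comp (R.U r : R.H →L[ℂ] R.H)).integral_comp_comm
      (R.integrable_integrand g h)).symm
    rw [ContinuousLinearMap.comp_apply] at this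
    rw [this, ← integral_mul_left_eq_self _ r⁻¹]
    refine integral_congr_ae (.of_forall fun s => ?_)
    simp only
    rw [ContinuousLinearMap.comp_apply, ← R.covariant_apply, ← R.U_mul_apply, map_mul R.π,
      mul_apply_eq_comp, mul_inv_cancel_left]
  simp only [hL, hR]
  refine integral_integral_swap_of_hasCompactSupport ?_ ?_
  · exact (R.continuous_π.comp (f.continuous_convIntegrand g)).clm_apply
      ((R.continuous_U h).comp continuous_fst)
  refine HasCompactSupport.intro ((f.isCompact_tsupport.prod g.isCompact_tsupport).image
    (f := fun q : G × G => (q.1 * q.2, q.1)) (by fun_prop)) ?_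
  rintro ⟨r, t⟩ hrt
  simp only [uncurry_apply_pair]
  by_cases ht : t ∈ tsupport f
  · rw [ConvAlg.eq_zero_of_notMem (f := g) (s := t⁻¹ * r), map_zero, mul_zero, map_zero,
      _root_.zero_apply]
    exact fun hg => hrt ⟨(t, t⁻¹ * r), ⟨ht, hg⟩, by simp⟩
  · rw [ConvAlg.eq_zero_of_notMem ht, zero_mul, map_zero, _root_.zero_apply]

theorem integratedOp_star (f : ConvAlg α μ) :
    R.integratedOp (star f) = star (R.integratedOp f) := by
  rw [ContinuousLinearMap.star_eq_adjoint, ContinuousLinearMap.eq_adjoint_iff]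
  intro h k
  rw [← inner_conj_symm, ← inner_conj_symm h]
  congr 1
  rw [integratedOp_apply, ← integral_inner (R.integrable_integrand _ _)]
  have hF : ∀ s, inner ℂ k (R.π (star f s) ((R.U s : R.H →L[ℂ] R.H) h)) =
      modularFunction s⁻¹ • inner ℂ
        (R.π (f s⁻¹) ((R.U s⁻¹ : R.H →L[ℂ] R.H) k)) h := fun s => by
    rw [ConvAlg.star_apply, map_smul, _root_.smul_apply, R.covariant_apply,
      inner_smul_right, Complex.real_smul]
    congr 1
    have := R.inner_U_apply s⁻¹ k (R.π (star (f s⁻¹)) h)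
    rw [inv_inv] at this
    rw [this, map_star, ContinuousLinearMap.star_eq_adjoint,
      ContinuousLinearMap.adjoint_inner_right]
  simp only [hF]
  have hc : Continuous fun s => inner ℂ (R.π (f s) ((R.U s : R.H →L[ℂ] R.H) k)) h :=
    (R.continuous_integrand f k).inner continuous_const
  rw [integral_inv_modular μ hc (HasCompactSupport.intro f.isCompact_tsupport fun s hs => by
    rw [R.integrand_eq_zero f k hs, inner_zero_left])]
  have : ∀ s, inner ℂ (R.π (f s) ((R.U s : R.H →L[ℂ] R.H) k)) h =
      starRingEnd ℂ (inner ℂ h (R.π (f s) ((R.U s : R.H →L[ℂ] R.H) k))) :=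
    fun s => (inner_conj_symm _ _).symm
  simp only [this]
  rw [integral_conj, integral_inner (R.integrable_integrand _ _), inner_conj_symm]
  rfl

/-- The ⋆-representation `π × U` of `C_c(G, A)`. -/
def integrated : ConvAlg α μ →⋆ₙₐ[ℂ] (R.H →L[ℂ] R.H) where
  toFun := R.integratedOp
  map_zero' := by
    ext h
    simp [integratedOp_apply, ConvAlg.zero_apply]
  map_add' f g := by
    ext h
    rw [_root_.add_apply, integratedOp_apply, integratedOp_apply, integratedOp_apply,
      ← integral_add (R.integrable_integrand f h) (R.integrable_integrand g h)]
    simp only [ConvAlg.add_apply, map_add, _root_.add_apply]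
  map_smul' c f := by
    ext h
    rw [MonoidHom.id_apply, _root_.smul_apply, integratedOp_apply, integratedOp_apply,
      ← integral_smul]
    simp only [ConvAlg.smul_apply, map_smul, _root_.smul_apply]
  map_mul' := R.integratedOp_mul
  map_star' := R.integratedOp_star

theorem norm_integrated_le (f : ConvAlg α μ) : ‖R.integrated f‖ ≤ ∫ s, ‖f s‖ ∂μ :=
  R.norm_integratedOp_le f

end CovariantRep

section Regular

variable {G : Type v} [Group G] [TopologicalSpace G] [IsTopologicalGroup G] [LocallyCompactSpace G]
  [MeasurableSpace G] [BorelSpace G] {μ : Measure G} [μ.IsHaarMeasure] [μ.InnerRegularCompactLTTop]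

section MulOp

variable {H : Type w} [NormedAddCommGroup H] [InnerProductSpace ℂ H] {T : G → H →L[ℂ] H}

theorem aestronglyMeasurable_restrict {E : Type*} [TopologicalSpace E]
    [TopologicalSpace.PseudoMetrizableSpace E] {F : G → E} (hF : Continuous F) {s : Set G}
    (hs : MeasurableSet s) (hμ : μ s ≠ ⊤) : AEStronglyMeasurable F (μ.restrict s) := by
  have hex : ∀ n : ℕ, ∃ K ⊆ s, IsCompact K ∧ IsClosed K ∧ μ (s \ K) < ((n : ENNReal) + 1)⁻¹ :=
    fun n => hs.exists_isCompact_isClosed_sdiff_lt hμ (by simp)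
  choose K hKs hK hKc hKμ using hex
  have hU : AEStronglyMeasurable F (μ.restrict (⋃ n, K n)) :=
    aestronglyMeasurable_iUnion_iff.2 fun n =>
      hF.continuousOn.aestronglyMeasurable_of_isCompact (hK n) (hKc n).measurableSet
  have hnull : μ (s \ ⋃ n, K n) = 0 := by
    refine le_antisymm (ge_of_tendsto' (x := Filter.atTop) (f := fun n : ℕ => ((n : ENNReal) + 1)⁻¹)
      ?_ fun n => ?_) zero_le
    · exact_mod_cast (Filter.tendsto_add_atTop_iff_nat 1).2 ENNReal.tendsto_inv_nat_nhds_zero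
    · exact (measure_mono (Set.sdiff_subset_sdiff_right (Set.subset_iUnion K n))).trans (hKμ n).le
  have hae : (⋃ n, K n : Set G) =ᵐ[μ] s :=
    Filter.EventuallyLE.antisymm (Set.iUnion_subset hKs).eventuallyLE (ae_le_set.2 hnull)
  rwa [Measure.restrict_congr_set hae] at hU

theorem aestronglyMeasurable_mulOp (hT : Continuous T) (h : Lp H 2 μ) :
    AEStronglyMeasurable (fun r => T r (h r)) μ := by
  obtain ⟨fs, hfin, hlim⟩ := Lp.finStronglyMeasurable h (by norm_num) (by norm_num)
  refine aestronglyMeasurable_of_tendsto_ae Filter.atTop (f := fun n r => T r (fs n r))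
    (fun n => ?_) (.of_forall fun r => ((T r).continuous.tendsto _).comp (hlim r))
  have hS : MeasurableSet (support (fs n)) := (fs n).measurableSet_support
  have hind : (support (fs n)).indicator (fun r => T r (fs n r)) = fun r => T r (fs n r) :=
    Set.indicator_eq_self.2 fun r hr => by
      contrapose! hr
      simp only [mem_support, not_not] at hr ⊢
      rw [hr, map_zero]
  rw [← hind, aestronglyMeasurable_indicator_iff hS]
  exact isBoundedBilinearMap_apply.continuous.comp_aestronglyMeasurable
    ((aestronglyMeasurable_restrict hT hS (hfin n).ne).prodMk
      (fs n).stronglyMeasurable.aestronglyMeasurable)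

theorem memLp_mulOp (hT : Continuous T) {C : ℝ} (hC : ∀ r, ‖T r‖ ≤ C) (h : Lp H 2 μ) :
    MemLp (fun r => T r (h r)) 2 μ :=
  (Lp.memLp h).of_le_mul (c := C) (aestronglyMeasurable_mulOp hT h)
    (.of_forall fun r => (T r).le_of_opNorm_le (hC r) _)

/-- The decomposable operator `(mulOp T h) r = T r (h r)` on `L²(G, H)` defined by a bounded
continuous operator-valued function `T`. -/
def mulOp (μ : Measure G) [μ.IsHaarMeasure] [μ.InnerRegularCompactLTTop] (T : G → H →L[ℂ] H) (hT : Continuous T)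
    (C : ℝ) (hC : ∀ r, ‖T r‖ ≤ C) : Lp H 2 μ →L[ℂ] Lp H 2 μ :=
  LinearMap.mkContinuous
    { toFun := fun h => (memLp_mulOp hT hC h).toLp _
      map_add' := fun h k => by
        refine Lp.ext ?_
        filter_upwards [(memLp_mulOp hT hC (h + k)).coeFn_toLp, (memLp_mulOp hT hC h).coeFn_toLp,
          (memLp_mulOp hT hC k).coeFn_toLp, Lp.coeFn_add h k,
          Lp.coeFn_add ((memLp_mulOp hT hC h).toLp _) ((memLp_mulOp hT hC k).toLp _)]
          with r h1 h2 h3 h4 h5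
        rw [h1, h5, Pi.add_apply, h2, h3, h4, Pi.add_apply, map_add]
      map_smul' := fun c h => by
        refine Lp.ext ?_
        filter_upwards [(memLp_mulOp hT hC (c • h)).coeFn_toLp, (memLp_mulOp hT hC h).coeFn_toLp,
          Lp.coeFn_smul c h, Lp.coeFn_smul c ((memLp_mulOp hT hC h).toLp _)] with r h1 h2 h3 h4
        rw [RingHom.id_apply, h1, h4, Pi.smul_apply, h2, h3, Pi.smul_apply, map_smul] }
    C fun h => by
      refine Lp.norm_le_mul_norm_of_ae_le_mul ?_
      filter_upwards [(memLp_mulOp hT hC h).coeFn_toLp] with r h1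
      simp only [LinearMap.coe_mk, AddHom.coe_mk]
      rw [h1]
      exact (T r).le_of_opNorm_le (hC r) _

theorem mulOp_coeFn (hT : Continuous T) {C : ℝ} (hC : ∀ r, ‖T r‖ ≤ C) (h : Lp H 2 μ) :
    mulOp μ T hT C hC h =ᵐ[μ] fun r => T r (h r) :=
  (memLp_mulOp hT hC h).coeFn_toLp

end MulOp

/-- Left translation `(U s h) r = h (s⁻¹ r)` on `L²(G, H)`, as a homomorphism into the isometric
linear automorphisms. -/
def leftTranslation (μ : Measure G) [μ.IsHaarMeasure] [μ.InnerRegularCompactLTTop] (H : Type w)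
    [NormedAddCommGroup H] [InnerProductSpace ℂ H] : G →* (Lp H 2 μ ≃ₗᵢ[ℂ] Lp H 2 μ) where
  toFun s :=
    { toFun := fun h => DomMulAct.mk s⁻¹ • h
      invFun := fun h => DomMulAct.mk s • h
      map_add' := fun h k => smul_add _ h k
      map_smul' := fun c h => smul_comm _ c h
      left_inv := fun h => by simp [smul_smul]
      right_inv := fun h => by simp [smul_smul]
      norm_map' := fun h => DomMulAct.norm_smul_Lp _ h }
  map_one' := by
    ext1 h
    change DomMulAct.mk (1 : G)⁻¹ • h = h
    simp
  map_mul' s t := by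
    ext1 h
    change DomMulAct.mk (s * t)⁻¹ • h = DomMulAct.mk s⁻¹ • DomMulAct.mk t⁻¹ • h
    rw [smul_smul, ← DomMulAct.mk_mul, mul_inv_rev]

theorem leftTranslation_coeFn {H : Type w} [NormedAddCommGroup H] [InnerProductSpace ℂ H] (s : G)
    (h : Lp H 2 μ) : leftTranslation μ H s h =ᵐ[μ] fun r => h (s⁻¹ * r) :=
  DomMulAct.smul_Lp_ae_eq (DomMulAct.mk s⁻¹) h

theorem continuous_leftTranslation {H : Type w} [NormedAddCommGroup H] [InnerProductSpace ℂ H]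
    (h : Lp H 2 μ) : Continuous fun s => leftTranslation μ H s h := by
  have : Fact ((2 : ENNReal) ≠ ⊤) := ⟨by norm_num⟩
  exact (DomMulAct.continuous_mk.comp continuous_inv).smul continuous_const

variable {A B : Type u} [NonUnitalCStarAlgebra A] [NonUnitalCStarAlgebra B]

theorem continuous_regular (α : CStarAction G A) (ρ : HilbertRep.{u, w} A) (a : A) :
    Continuous fun r : G => ρ.π (α r⁻¹ a) :=
  ρ.continuous_π.comp ((α.continuous_orbit a).comp continuous_inv)

theorem norm_regular_le (α : CStarAction G A) (ρ : HilbertRep.{u, w} A) (a : A) (r : G) :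
    ‖ρ.π (α r⁻¹ a)‖ ≤ ‖a‖ :=
  (NonUnitalStarAlgHom.norm_apply_le ρ.π _).trans (α.norm_apply _ _).le

/-- The operator `(ρ̃ a h) r = ρ (α r⁻¹ a) (h r)` on `L²(G, H)`. -/
def regularOp (μ : Measure G) [μ.IsHaarMeasure] [μ.InnerRegularCompactLTTop] (α : CStarAction G A)
    (ρ : HilbertRep.{u, w} A) (a : A) : Lp ρ.H 2 μ →L[ℂ] Lp ρ.H 2 μ :=
  mulOp μ (fun r => ρ.π (α r⁻¹ a)) (continuous_regular α ρ a) ‖a‖ (norm_regular_le α ρ a)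

theorem regularOp_coeFn (α : CStarAction G A) (ρ : HilbertRep.{u, w} A) (a : A)
    (h : Lp ρ.H 2 μ) : regularOp μ α ρ a h =ᵐ[μ] fun r => ρ.π (α r⁻¹ a) (h r) :=
  mulOp_coeFn (continuous_regular α ρ a) (norm_regular_le α ρ a) h

/-- The representation `ρ̃` of `A` on `L²(G, H)`. -/
def regularHom (μ : Measure G) [μ.IsHaarMeasure] [μ.InnerRegularCompactLTTop] (α : CStarAction G A)
    (ρ : HilbertRep.{u, w} A) : A →⋆ₙₐ[ℂ] (Lp ρ.H 2 μ →L[ℂ] Lp ρ.H 2 μ) where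
  toFun := regularOp μ α ρ
  map_zero' := by
    ext1 h
    refine Lp.ext ?_
    filter_upwards [regularOp_coeFn α ρ 0 h, Lp.coeFn_zero ρ.H 2 μ] with r h1 h2
    rw [h1, _root_.zero_apply, h2, map_zero, map_zero, _root_.zero_apply, Pi.zero_apply]
  map_add' a b := by
    ext1 h
    refine Lp.ext ?_
    filter_upwards [regularOp_coeFn α ρ (a + b) h, regularOp_coeFn α ρ a h,
      regularOp_coeFn α ρ b h, Lp.coeFn_add (regularOp μ α ρ a h) (regularOp μ α ρ b h)]
      with r h1 h2 h3 h4
    rw [h1, _root_.add_apply, h4, Pi.add_apply, h2, h3, map_add, map_add, _root_.add_apply]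
  map_smul' c a := by
    ext1 h
    refine Lp.ext ?_
    filter_upwards [regularOp_coeFn α ρ (c • a) h, regularOp_coeFn α ρ a h,
      Lp.coeFn_smul c (regularOp μ α ρ a h)] with r h1 h2 h3
    rw [h1, MonoidHom.id_apply, _root_.smul_apply, h3, Pi.smul_apply, h2, map_smul, map_smul,
      _root_.smul_apply]
  map_mul' a b := by
    ext1 h
    refine Lp.ext ?_
    filter_upwards [regularOp_coeFn α ρ (a * b) h, regularOp_coeFn α ρ b h,
      regularOp_coeFn α ρ a (regularOp μ α ρ b h)] with r h1 h2 h3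
    rw [h1, mul_apply_eq_comp, h3, h2, map_mul (α r⁻¹), map_mul ρ.π, mul_apply_eq_comp]
  map_star' a := by
    rw [ContinuousLinearMap.star_eq_adjoint, ContinuousLinearMap.eq_adjoint_iff]
    intro h k
    rw [L2.inner_def, L2.inner_def]
    refine integral_congr_ae ?_
    filter_upwards [regularOp_coeFn α ρ (star a) h, regularOp_coeFn α ρ a k] with r h1 h2
    rw [h1, h2, map_star, map_star, ContinuousLinearMap.star_eq_adjoint,
      ContinuousLinearMap.adjoint_inner_left]

/-- The left regular covariant representation `(ρ̃, U)` on `L²(G, H)` associated with a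
representation `ρ` of `A` on `H`. -/
def CovariantRep.regular (μ : Measure G) [μ.IsHaarMeasure] [μ.InnerRegularCompactLTTop] (α : CStarAction G A)
    (ρ : HilbertRep.{u, max u v} A) : CovariantRep α where
  H := Lp ρ.H 2 μ
  π := regularHom μ α ρ
  U := (Unitary.linearIsometryEquiv (𝕜 := ℂ) (H := Lp ρ.H 2 μ)).symm.toMonoidHom.comp
    (leftTranslation μ ρ.H)
  continuous_U := continuous_leftTranslation
  covariant s a := by
    set V := (Unitary.linearIsometryEquiv (𝕜 := ℂ) (H := Lp ρ.H 2 μ)).symm.toMonoidHom.comp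
      (leftTranslation μ ρ.H) with hV
    have hcomm : regularHom μ α ρ (α s a) * (V s : Lp ρ.H 2 μ →L[ℂ] Lp ρ.H 2 μ) =
        (V s : Lp ρ.H 2 μ →L[ℂ] Lp ρ.H 2 μ) * regularHom μ α ρ a := by
      ext1 h
      refine Lp.ext ?_
      rw [mul_apply_eq_comp, mul_apply_eq_comp]
      change regularOp μ α ρ (α s a) (leftTranslation μ ρ.H s h) =ᵐ[μ]
        leftTranslation μ ρ.H s (regularOp μ α ρ a h)
      filter_upwards [regularOp_coeFn α ρ (α s a) (leftTranslation μ ρ.H s h),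
        leftTranslation_coeFn s h, leftTranslation_coeFn s (regularOp μ α ρ a h),
        (measurePreserving_mul_left μ s⁻¹).quasiMeasurePreserving.ae
          (regularOp_coeFn α ρ a h)] with r h1 h2 h3 h4
      rw [h1, h2, h3, h4, ← α.mul_apply, mul_inv_rev, inv_inv]
    have hu : (V s : Lp ρ.H 2 μ →L[ℂ] Lp ρ.H 2 μ) *
        star (V s : Lp ρ.H 2 μ →L[ℂ] Lp ρ.H 2 μ) = 1 := Unitary.coe_mul_star_self (V s)
    rw [← hcomm, mul_assoc, hu, mul_one]

end Regular

section CrossedProducts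

variable {G : Type v} [Group G] [TopologicalSpace G] [IsTopologicalGroup G] [LocallyCompactSpace G]
  [MeasurableSpace G] [BorelSpace G] {A B : Type u} [NonUnitalCStarAlgebra A]
  [NonUnitalCStarAlgebra B]

/-- The universal C⋆-norm on `C_c(G, A)`: the supremum of `‖(π × U) f‖` over all covariant
representations `(π, U)`. The Hilbert spaces range over the universe of `C_c(G, A)`, which contains
those of all cyclic representations. -/
def fullNorm (α : CStarAction G A) (μ : Measure G) [μ.IsHaarMeasure] :
    CStarSeminorm (ConvAlg α μ) :=
  CStarSeminorm.ofFamily (fun R : CovariantRep α => R.integrated)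
    fun f => ⟨∫ s, ‖f s‖ ∂μ, by rintro _ ⟨R, rfl⟩; exact R.norm_integrated_le f⟩

/-- The reduced C⋆-norm on `C_c(G, A)`: the supremum of `‖(ρ̃ × U) f‖` over the left regular
representations associated with all representations `ρ` of `A`. -/
def reducedNorm (α : CStarAction G A) (μ : Measure G) [μ.IsHaarMeasure] [μ.InnerRegularCompactLTTop] :
    CStarSeminorm (ConvAlg α μ) :=
  CStarSeminorm.ofFamily
    (fun ρ : HilbertRep.{u, max u v} A => (CovariantRep.regular μ α ρ).integrated)
    fun f => ⟨∫ s, ‖f s‖ ∂μ, by rintro _ ⟨ρ, rfl⟩; exact CovariantRep.norm_integrated_le _ f⟩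

/-- The full (maximal) crossed product `A ⋊ G`: the completion of `C_c(G, A)` for the universal
norm. -/
abbrev FullCrossedProduct (α : CStarAction G A) (μ : Measure G) [μ.IsHaarMeasure] :
    Type (max u v) := (fullNorm α μ).Completion

/-- The reduced crossed product `A ⋊ᵣ G`: the completion of `C_c(G, A)` for the reduced norm. -/
abbrev ReducedCrossedProduct (α : CStarAction G A) (μ : Measure G) [μ.IsHaarMeasure] [μ.InnerRegularCompactLTTop] :
    Type (max u v) := (reducedNorm α μ).Completion

/-- The ⋆-homomorphism `f ↦ φ ∘ f` from `C_c(G, A)` to `C_c(G, B)` defined by an equivariant morphism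
`φ : A → B`. -/
def ConvAlg.map {α : CStarAction G A} {β : CStarAction G B} (μ : Measure G) [μ.IsHaarMeasure]
    (φ : A →⋆ₙₐ[ℂ] B) (hφ : ∀ s a, φ (α s a) = β s (φ a)) : ConvAlg α μ →⋆ₙₐ[ℂ] ConvAlg β μ :=
  have hc : Continuous φ := AddMonoidHomClass.continuous_of_bound φ 1
    fun a => by simpa using NonUnitalStarAlgHom.norm_apply_le φ a
  { toFun := fun f => ConvAlg.mk (fun s => φ (f s)) (hc.comp f.continuous)
      (HasCompactSupport.intro f.isCompact_tsupport fun s hs => by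
        rw [ConvAlg.eq_zero_of_notMem hs, map_zero])
    map_zero' := ConvAlg.ext fun s => map_zero φ
    map_add' := fun f g => ConvAlg.ext fun s => map_add φ (f s) (g s)
    map_smul' := fun c f => ConvAlg.ext fun s => map_smul φ c (f s)
    map_mul' := fun f g => ConvAlg.ext fun s => by
      let φL : A →L[ℂ] B :=
        { toFun := φ, map_add' := map_add φ, map_smul' := map_smul φ, cont := hc }
      have h1 : φ ((f * g) s) = ∫ r, φ (f r * α r (g (r⁻¹ * s))) ∂μ :=
        (φL.integral_comp_comm (f.integrable_convIntegrand g s)).symm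
      change φ ((f * g) s) = ∫ r, φ (f r) * β r (φ (g (r⁻¹ * s))) ∂μ
      rw [h1]
      simp only [map_mul φ, hφ]
    map_star' := fun f => ConvAlg.ext fun s => by
      change φ ((modularFunction s⁻¹ : ℂ) • α s (star (f s⁻¹))) =
        (modularFunction s⁻¹ : ℂ) • β s (star (φ (f s⁻¹)))
      rw [map_smul, hφ, map_star φ] }

theorem ConvAlg.map_apply {α : CStarAction G A} {β : CStarAction G B} (μ : Measure G)
    [μ.IsHaarMeasure] (φ : A →⋆ₙₐ[ℂ] B) (hφ : ∀ s a, φ (α s a) = β s (φ a)) (f : ConvAlg α μ)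
    (s : G) : ConvAlg.map μ φ hφ f s = φ (f s) := rfl

theorem regularOp_map {α : CStarAction G A} {β : CStarAction G B} (μ : Measure G)
    [μ.IsHaarMeasure] [μ.InnerRegularCompactLTTop] (φ : A →⋆ₙₐ[ℂ] B)
    (hφ : ∀ s a, φ (α s a) = β s (φ a)) (ρ : HilbertRep.{u, max u v} B) (a : A) :
    regularOp μ β ρ (φ a) = regularOp μ α (ρ.comp φ) a := by
  ext1 h
  refine Lp.ext ?_
  filter_upwards [regularOp_coeFn β ρ (φ a) h, regularOp_coeFn α (ρ.comp φ) a h] with r h1 h2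
  rw [h1, ← hφ]
  exact h2.symm

theorem norm_regular_integrated_map {α : CStarAction G A} {β : CStarAction G B} (μ : Measure G)
    [μ.IsHaarMeasure] [μ.InnerRegularCompactLTTop] (φ : A →⋆ₙₐ[ℂ] B)
    (hφ : ∀ s a, φ (α s a) = β s (φ a)) (ρ : HilbertRep.{u, max u v} B) (f : ConvAlg α μ) :
    ‖(CovariantRep.regular μ β ρ).integrated (ConvAlg.map μ φ hφ f)‖ =
      ‖(CovariantRep.regular μ α (ρ.comp φ)).integrated f‖ := by
  have key : ∀ h : Lp ρ.H 2 μ,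
      (∫ s, regularOp μ β ρ (φ (f s)) (leftTranslation μ ρ.H s h) ∂μ : Lp ρ.H 2 μ) =
        (∫ s, regularOp μ α (ρ.comp φ) (f s) (leftTranslation μ ρ.H s h) ∂μ : Lp ρ.H 2 μ) :=
    fun h => integral_congr_ae (.of_forall fun s =>
      DFunLike.congr_fun (regularOp_map μ φ hφ ρ (f s)) (leftTranslation μ ρ.H s h))
  have heq : @Eq (Lp ρ.H 2 μ →L[ℂ] Lp ρ.H 2 μ)
      ((CovariantRep.regular μ β ρ).integrated (ConvAlg.map μ φ hφ f))
      ((CovariantRep.regular μ α (ρ.comp φ)).integrated f) := ContinuousLinearMap.ext key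
  exact congrArg (fun T : Lp ρ.H 2 μ →L[ℂ] Lp ρ.H 2 μ => ‖T‖) heq

theorem fullNorm_map_le {α : CStarAction G A} {β : CStarAction G B} (μ : Measure G)
    [μ.IsHaarMeasure] (φ : A →⋆ₙₐ[ℂ] B) (hφ : ∀ s a, φ (α s a) = β s (φ a)) (f : ConvAlg α μ) :
    (fullNorm β μ).toFun (ConvAlg.map μ φ hφ f) ≤ (fullNorm α μ).toFun f :=
  ciSup_le fun R => le_ciSup (f := fun R : CovariantRep α => ‖R.integrated f‖)
    ⟨∫ s, ‖f s‖ ∂μ, by rintro _ ⟨R, rfl⟩; exact R.norm_integrated_le f⟩ (R.comp φ hφ)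

theorem reducedNorm_map_le {α : CStarAction G A} {β : CStarAction G B} (μ : Measure G)
    [μ.IsHaarMeasure] [μ.InnerRegularCompactLTTop] (φ : A →⋆ₙₐ[ℂ] B)
    (hφ : ∀ s a, φ (α s a) = β s (φ a)) (f : ConvAlg α μ) :
    (reducedNorm β μ).toFun (ConvAlg.map μ φ hφ f) ≤ (reducedNorm α μ).toFun f :=
  ciSup_le fun ρ => by
    rw [norm_regular_integrated_map]
    exact le_ciSup (f := fun ρ : HilbertRep.{u, max u v} A =>
      ‖(CovariantRep.regular μ α ρ).integrated f‖)
      ⟨∫ s, ‖f s‖ ∂μ, by rintro _ ⟨R, rfl⟩; exact CovariantRep.norm_integrated_le _ f⟩ (ρ.comp φ)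

/-- The morphism `φ_* : A ⋊ G → B ⋊ G` extending `f ↦ φ ∘ f` on `C_c(G, A)`. -/
def FullCrossedProduct.map {α : CStarAction G A} {β : CStarAction G B} (μ : Measure G)
    [μ.IsHaarMeasure] (φ : A →⋆ₙₐ[ℂ] B) (hφ : ∀ s a, φ (α s a) = β s (φ a)) :
    FullCrossedProduct α μ →⋆ₙₐ[ℂ] FullCrossedProduct β μ :=
  CStarSeminorm.mapCompletion (fullNorm α μ) (fullNorm β μ) (ConvAlg.map μ φ hφ)
    (fullNorm_map_le μ φ hφ)

/-- The morphism `φ_{*,r} : A ⋊ᵣ G → B ⋊ᵣ G` extending `f ↦ φ ∘ f` on `C_c(G, A)`. -/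
def ReducedCrossedProduct.map {α : CStarAction G A} {β : CStarAction G B} (μ : Measure G)
    [μ.IsHaarMeasure] [μ.InnerRegularCompactLTTop] (φ : A →⋆ₙₐ[ℂ] B)
    (hφ : ∀ s a, φ (α s a) = β s (φ a)) :
    ReducedCrossedProduct α μ →⋆ₙₐ[ℂ] ReducedCrossedProduct β μ :=
  CStarSeminorm.mapCompletion (reducedNorm α μ) (reducedNorm β μ) (ConvAlg.map μ φ hφ)
    (reducedNorm_map_le μ φ hφ)

/-- The canonical morphism `S ⋊ G → A ⋊ G` induced by the inclusion of an invariant C⋆-subalgebra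
`S` of `A`. -/
def FullCrossedProduct.inclusion (α : CStarAction G A) (μ : Measure G) [μ.IsHaarMeasure]
    (S : NonUnitalStarSubalgebra ℂ A) [IsClosed (S : Set A)] (hS : ∀ g, ∀ a ∈ S, α g a ∈ S) :
    FullCrossedProduct (α.restrict S hS) μ →⋆ₙₐ[ℂ] FullCrossedProduct α μ :=
  FullCrossedProduct.map μ (NonUnitalStarSubalgebraClass.subtype S) fun _ _ => rfl

/-- The canonical morphism `S ⋊ᵣ G → A ⋊ᵣ G` induced by the inclusion of an invariant C⋆-subalgebra
`S` of `A`. -/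
def ReducedCrossedProduct.inclusion (α : CStarAction G A) (μ : Measure G) [μ.IsHaarMeasure]
    [μ.InnerRegularCompactLTTop] (S : NonUnitalStarSubalgebra ℂ A) [IsClosed (S : Set A)]
    (hS : ∀ g, ∀ a ∈ S, α g a ∈ S) :
    ReducedCrossedProduct (α.restrict S hS) μ →⋆ₙₐ[ℂ] ReducedCrossedProduct α μ :=
  ReducedCrossedProduct.map μ (NonUnitalStarSubalgebraClass.subtype S) fun _ _ => rfl

end CrossedProducts

end CrossedProduct

end

open MeasureTheory Function Filter Topology
open scoped CompactlySupported

noncomputable section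

namespace CrossedProduct

universe u v w

/-! ### Approximate units of a closed ⋆-subalgebra, acting on the ambient algebra -/

section ApproximateUnit

/-! Everything rests on ⋆-endomorphisms `P i` of the graded algebra that are the identity on the
components `S j` with `i ≤ j` and zero on all the others (`IsCStarGrading.exists_hom`).
Algebraically such a map is clear: the indices above `i` span a subalgebra, and the remaining ones
span an ideal. The point is continuity. For a finite inf-closed set of indices, the sum of the
components is closed, by removing a maximal index `k`: the rest is an ideal `I` of the sum, closed
by induction, and `b ↦ dist (b, I)` is a C⋆-seminorm on `S k` that vanishes only at `0` by
independence. An injective ⋆-homomorphism of C⋆-algebras is isometric, so `‖b‖ = dist (b, I) ≤ ‖b +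
x‖` for `x` in `I` (`norm_le_norm_add_of_disjoint`), and this makes the sum closed. The same
estimate for the indices above `i` against the others, first inside finite inf-closed sets and then
on closures, gives the bounded projection `P i`.

Moreover `P i a * x` lies in `S i` for `x` in `S i`, so the whole algebra acts on `S i` by
multipliers. A possibly degenerate representation of `S i` therefore extends to the whole algebra on
the same Hilbert space, as a strong limit along an approximate unit (`exists_extension`). Since `P
i` commutes with the action, covariant representations extend too. Hence the norms of `C_c(G, S i)`
are the restrictions of those of `C_c(G, A)`, and the canonical morphisms are isometric
(`fullNorm_inclusion`, `reducedNorm_inclusion`).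

The grading of the crossed products follows formally and simultaneously for both norms. Independence
comes from the maps that the `P i` induce on the completion, tested at a maximal index of a
vanishing sum. Totality holds because elementary functions with values in the components span an
L¹-dense subspace. The product rule holds because a convolution of functions with values in `S i`
and `S j` is an integral of elements of the closed subspace `S (i ⊓ j)`. -/

open Unitization CStarAlgebra in
theorem norm_sub_mul_le_of_nonneg {A : Type*} [NonUnitalCStarAlgebra A] [PartialOrder A]
    [StarOrderedRing A] {e : A} (he : 0 ≤ e) (he1 : ‖e‖ ≤ 1) (w : A) : ‖w - w * e‖ ≤ ‖w‖ := by
  -- In the unitization `w - w * e` is `w * (1 - e)`, and `0 ≤ e ≤ 1` makes `1 - e` a contraction.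
  have h0 : (0 : A⁺¹) ≤ (e : A⁺¹) := by rwa [inr_nonneg_iff]
  have h1 : (e : A⁺¹) ≤ 1 := by
    rw [← norm_le_one_iff_of_nonneg _ h0, norm_inr]; exact he1
  have h2 : ‖(1 : A⁺¹) - e‖ ≤ 1 :=
    (norm_le_one_iff_of_nonneg _ (sub_nonneg.2 h1)).2 (sub_le_self _ h0)
  calc ‖w - w * e‖ = ‖(w : A⁺¹) * (1 - e)‖ := by
        rw [← norm_inr (𝕜 := ℂ), inr_sub, inr_mul, mul_sub, mul_one]
    _ ≤ ‖(w : A⁺¹)‖ * ‖(1 : A⁺¹) - e‖ := norm_mul_le _ _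
    _ ≤ ‖w‖ := by
        rw [norm_inr]; exact mul_le_of_le_one_right (norm_nonneg _) h2

/-- A closed ⋆-subalgebra of a C⋆-algebra has a self-adjoint contractive approximate unit `e` such
that `w ↦ w (1 - e)` is contractive on the ambient algebra. -/
theorem exists_approximateUnit {A : Type*} [NonUnitalCStarAlgebra A]
    (I : NonUnitalStarSubalgebra ℂ A) (hI : IsClosed (I : Set A)) :
    ∃ l : Filter I, l.NeBot ∧
      (∀ᶠ e : I in l, star e = e ∧ ‖e‖ ≤ 1 ∧ ∀ w : A, ‖w - w * (e : A)‖ ≤ ‖w‖) ∧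
      (∀ x : I, Tendsto (fun e => x * e) l (𝓝 x)) ∧ ∀ x : I, Tendsto (fun e => e * x) l (𝓝 x) := by
  have := hI
  let _ := CStarAlgebra.spectralOrder A
  have := CStarAlgebra.spectralOrderedRing A
  let _ := CStarAlgebra.spectralOrder I
  have := CStarAlgebra.spectralOrderedRing I
  have h := CStarAlgebra.increasingApproximateUnit I
  refine ⟨CStarAlgebra.approximateUnit I, h.neBot, ?_, h.tendsto_mul_left, h.tendsto_mul_right⟩
  filter_upwards [h.eventually_star_eq, h.eventually_nonneg, h.eventually_norm] with e h1 h2 h3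
  refine ⟨h1, h3, fun w => norm_sub_mul_le_of_nonneg (e := (e : A)) ?_ h3 w⟩
  -- Positivity for the order of `I` passes to the order of `A` because it is witnessed by a
  -- factorization `star c * c`.
  obtain ⟨c, hc⟩ := CStarAlgebra.nonneg_iff_eq_star_mul_self.1 h2
  rw [hc]
  exact star_mul_self_nonneg (c : A)

end ApproximateUnit

/-! ### The quotient C⋆-seminorm and the projection along an ideal -/

section Quotient

theorem exists_gt_lt_of_continuous {f : ℝ → ℝ} (hf : Continuous f) {a r : ℝ} (h : f a < r) :
    ∃ s > a, f s < r := by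
  have h1 : ∀ᶠ s in 𝓝[>] a, f s < r :=
    ((hf.tendsto a).eventually_lt_const h).filter_mono nhdsWithin_le_nhds
  exact (h1.and self_mem_nhdsWithin).exists.imp fun s hs => ⟨hs.2, hs.1⟩

variable {A : Type u} [NonUnitalCStarAlgebra A] {B I : NonUnitalStarSubalgebra ℂ A}

theorem infDist_le_norm_add {I : NonUnitalStarSubalgebra ℂ A} (a : A) {x : A} (hx : x ∈ I) :
    Metric.infDist a (I : Set A) ≤ ‖a + x‖ := by
  have := Metric.infDist_le_dist_of_mem (x := a) (s := (I : Set A)) (neg_mem hx)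
  rwa [dist_eq_norm, sub_neg_eq_add] at this

theorem exists_norm_add_lt {I : NonUnitalStarSubalgebra ℂ A} {a : A} {r : ℝ}
    (h : Metric.infDist a (I : Set A) < r) : ∃ x ∈ I, ‖a + x‖ < r := by
  obtain ⟨y, hy, h⟩ := (Metric.infDist_lt_iff ⟨0, zero_mem I⟩).1 h
  exact ⟨-y, neg_mem hy, by rwa [dist_eq_norm, sub_eq_add_neg] at h⟩

/-- This is the hard half of the C⋆-identity for the quotient seminorm. For `e` in an approximate
unit of `I`, the distance is at most `‖b - b * e‖`, whose square is the norm of `(1 - e) b⋆ b (1 -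
e)`. Adding and subtracting `(1 - e) x (1 - e)` bounds it by `‖b⋆ b + x‖ + ‖x - x * e‖`, and the
last term tends to `0`. -/
theorem infDist_mul_self_le (hI : IsClosed (I : Set A)) (hBI : ∀ b ∈ B, ∀ x ∈ I, b * x ∈ I)
    {b : A} (hb : b ∈ B) {x : A} (hx : x ∈ I) :
    Metric.infDist b (I : Set A) * Metric.infDist b (I : Set A) ≤ ‖star b * b + x‖ := by
  obtain ⟨l, hl, h1, h2, -⟩ := exists_approximateUnit I hI
  have hlim : Tendsto (fun e : I => ‖star b * b + x‖ + ‖x - x * e‖) l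
      (𝓝 (‖star b * b + x‖ + ‖x - x‖)) :=
    tendsto_const_nhds.add ((tendsto_const_nhds.sub
      ((continuous_subtype_val.tendsto _).comp (h2 ⟨x, hx⟩))).norm)
  rw [sub_self, norm_zero, add_zero] at hlim
  refine ge_of_tendsto hlim ?_
  filter_upwards [h1] with e ⟨he, _, hw⟩
  have he' : star (e : A) = e := congrArg Subtype.val he
  have hw' : ∀ w : A, ‖w - e * w‖ ≤ ‖w‖ := fun w => by
    have := hw (star w)
    rwa [← norm_star, star_sub, star_mul, star_star, norm_star, he'] at this
  have h3 : Metric.infDist b (I : Set A) ≤ ‖b - b * e‖ := by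
    rw [sub_eq_add_neg]; exact infDist_le_norm_add b (neg_mem (hBI b hb e e.2))
  have h4 : star (b - b * (e : A)) * (b - b * e) =
      ((star b * b + x) - e * (star b * b + x) - ((star b * b + x) - e * (star b * b + x)) * e) -
        ((x - x * e) - e * (x - x * e)) := by
    rw [star_sub, star_mul, he']; noncomm_ring
  calc _ ≤ ‖b - b * (e : A)‖ * ‖b - b * (e : A)‖ :=
        mul_self_le_mul_self Metric.infDist_nonneg h3
    _ = ‖star (b - b * (e : A)) * (b - b * e)‖ := CStarRing.norm_star_mul_self.symm
    _ ≤ _ := by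
        rw [h4]
        refine (norm_sub_le _ _).trans (add_le_add ((hw _).trans (hw' _)) (hw' _))

/-- The quotient C⋆-seminorm `b ↦ dist (b, I)` on a subalgebra `B` normalizing the closed
⋆-subalgebra `I`. -/
def quotientSeminorm (hI : IsClosed (I : Set A)) (hBI : ∀ b ∈ B, ∀ x ∈ I, b * x ∈ I) :
    CStarSeminorm B :=
  have hIB : ∀ x ∈ I, ∀ b ∈ B, x * b ∈ I := fun x hx b hb => by
    have := star_mem (hBI _ (star_mem hb) _ (star_mem hx))
    rwa [star_mul, star_star, star_star] at this
  have hmul : ∀ b ∈ B, ∀ c ∈ B, Metric.infDist (b * c) (I : Set A) ≤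
      Metric.infDist b (I : Set A) * Metric.infDist c (I : Set A) := fun b hb c hc => by
    refine le_of_forall_gt_imp_ge_of_dense fun r hr => ?_
    obtain ⟨s, hs, hr⟩ : ∃ s > Metric.infDist b (I : Set A),
        s * Metric.infDist c (I : Set A) < r :=
      exists_gt_lt_of_continuous (continuous_id.mul continuous_const) hr
    obtain ⟨t, ht, hr⟩ : ∃ t > Metric.infDist c (I : Set A), s * t < r :=
      exists_gt_lt_of_continuous (continuous_const.mul continuous_id) hr
    obtain ⟨x, hx, hbx⟩ := exists_norm_add_lt hs
    obtain ⟨y, hy, hcy⟩ := exists_norm_add_lt ht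
    have h1 := infDist_le_norm_add (b * c)
      (add_mem (add_mem (hBI b hb y hy) (hIB x hx c hc)) (mul_mem hx hy))
    rw [show b * c + (b * y + x * c + x * y) = (b + x) * (c + y) by noncomm_ring] at h1
    exact (h1.trans ((norm_mul_le _ _).trans
      (mul_le_mul hbx.le hcy.le (norm_nonneg _) ((norm_nonneg _).trans hbx.le)))).trans hr.le
  have hstar : ∀ b, Metric.infDist (star b) (I : Set A) ≤ Metric.infDist b (I : Set A) :=
    fun b => le_of_forall_gt_imp_ge_of_dense fun r hr => by
      obtain ⟨x, hx, hbx⟩ := exists_norm_add_lt hr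
      have := infDist_le_norm_add (star b) (star_mem hx)
      rw [← star_add, norm_star] at this
      exact this.trans hbx.le
  have hsmul : ∀ (c : ℂ) (b : A), Metric.infDist (c • b) (I : Set A) ≤
      ‖c‖ * Metric.infDist b (I : Set A) := fun c b =>
    le_of_forall_gt_imp_ge_of_dense fun r hr => by
      obtain ⟨s, hs, hr⟩ : ∃ s > Metric.infDist b (I : Set A), ‖c‖ * s < r :=
        exists_gt_lt_of_continuous (continuous_const.mul continuous_id) hr
      obtain ⟨x, hx, hbx⟩ := exists_norm_add_lt hs
      have := infDist_le_norm_add (c • b) (SMulMemClass.smul_mem c hx)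
      rw [← smul_add, norm_smul] at this
      exact (this.trans (mul_le_mul_of_nonneg_left hbx.le (norm_nonneg c))).trans hr.le
  { toFun := fun b => Metric.infDist (b : A) (I : Set A)
    map_zero' := Metric.infDist_zero_of_mem (zero_mem I)
    add_le' := fun b c => le_of_forall_gt_imp_ge_of_dense fun r hr => by
      have hd : 0 < (r - (Metric.infDist (b : A) (I : Set A) +
        Metric.infDist (c : A) (I : Set A))) / 2 := by linarith
      obtain ⟨x, hx, hbx⟩ := exists_norm_add_lt (lt_add_of_pos_right
        (Metric.infDist (b : A) (I : Set A)) hd)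
      obtain ⟨y, hy, hcy⟩ := exists_norm_add_lt (lt_add_of_pos_right
        (Metric.infDist (c : A) (I : Set A)) hd)
      have h1 := infDist_le_norm_add ((b : A) + c) (add_mem hx hy)
      rw [add_add_add_comm] at h1
      have h2 := norm_add_le ((b : A) + x) (c + y)
      change Metric.infDist ((b : A) + c) (I : Set A) ≤ r
      linarith
    neg' := fun b => by
      have h1 := hsmul (-1) (b : A)
      have h2 := hsmul (-1) (-(b : A))
      simp only [neg_smul, one_smul, norm_neg, norm_one, one_mul, neg_neg] at h1 h2
      exact le_antisymm h1 h2
    smul' := fun c b => by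
      refine le_antisymm (hsmul c b) ?_
      rcases eq_or_ne c 0 with rfl | hc
      · simpa using Metric.infDist_nonneg
      -- The reverse inequality is the one already proved, applied to the scalar `c⁻¹`.
      · have := hsmul c⁻¹ (c • (b : A))
        rw [smul_smul, inv_mul_cancel₀ hc, one_smul, norm_inv] at this
        rwa [← le_inv_mul_iff₀ (norm_pos_iff.2 hc)]
    mul_le' := fun b c => hmul b b.2 c c.2
    star_mul_self' := fun b => by
      refine le_antisymm ((hmul _ (star_mem b.2) _ b.2).trans
        (mul_le_mul_of_nonneg_right (hstar b) Metric.infDist_nonneg)) ?_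
      refine le_of_forall_gt_imp_ge_of_dense fun r hr => ?_
      obtain ⟨x, hx, hbx⟩ := exists_norm_add_lt hr
      exact (infDist_mul_self_le hI hBI b.2 hx).trans hbx.le }

/-- If closed ⋆-subalgebras `B` and `I` intersect trivially and `B` normalizes `I`, then the
projection of `B + I` onto `B` is contractive. -/
theorem norm_le_norm_add_of_disjoint (hB : IsClosed (B : Set A)) (hI : IsClosed (I : Set A))
    (hBI : ∀ b ∈ B, ∀ x ∈ I, b * x ∈ I) (hd : ∀ a ∈ B, a ∈ I → a = 0)
    {b : A} (hb : b ∈ B) {x : A} (hx : x ∈ I) : ‖b‖ ≤ ‖b + x‖ := by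
  have := hB
  let p : CStarSeminorm B := quotientSeminorm hI hBI
  let φ : B →⋆ₙₐ[ℂ] p.Completion :=
    { toFun := fun b => ((show p.Pre from b : p.Pre) : p.Completion)
      map_zero' := UniformSpace.Completion.coe_zero
      map_add' := fun b c => UniformSpace.Completion.coe_add (α := p.Pre) b c
      map_mul' := fun b c => p.coe_mul b c
      map_smul' := fun c b => UniformSpace.Completion.coe_smul (X := p.Pre) c b
      map_star' := fun b => p.coe_star b }
  have hnorm : ∀ b : B, ‖φ b‖ = Metric.infDist (b : A) (I : Set A) := fun b =>
    UniformSpace.Completion.norm_coe (E := p.Pre) b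
  -- An element of the kernel is at distance `0` from the closed set `I`, so it lies in `B ∩ I`.
  -- Injectivity then forces `φ` to be isometric, that is, `‖b‖ = dist (b, I)`.
  have hinj : Injective φ := (injective_iff_map_eq_zero φ).2 fun b hb => by
    have h1 := hnorm b
    rw [hb, norm_zero] at h1
    have h2 := (hI.mem_iff_infDist_zero ⟨0, zero_mem I⟩).2 h1.symm
    exact Subtype.ext (hd b b.2 h2)
  have h1 := NonUnitalStarAlgHom.norm_map φ hinj ⟨b, hb⟩
  rw [hnorm] at h1
  exact (h1.symm.le).trans (infDist_le_norm_add b hx)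

/-- A sum of closed subspaces is closed if the projection onto the first summand is contractive. -/
theorem isClosed_sup_of_norm_le {E : Type*} [NormedAddCommGroup E] [NormedSpace ℂ E]
    [CompleteSpace E] {p q : Submodule ℂ E} (hp : IsClosed (p : Set E)) (hq : IsClosed (q : Set E))
    (h : ∀ x ∈ p, ∀ y ∈ q, ‖x‖ ≤ ‖x + y‖) : IsClosed ((p ⊔ q : Submodule ℂ E) : Set E) := by
  have := hp.completeSpace_coe
  have := hq.completeSpace_coe
  let T : p × q →L[ℂ] E := p.subtypeL.coprod q.subtypeL
  -- The constant is `2` since `‖y‖ ≤ ‖x + y‖ + ‖x‖ ≤ 2 * ‖x + y‖`.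
  have hT : AntilipschitzWith 2 T := T.antilipschitz_of_bound fun z => by
    have h1 := h z.1 z.1.2 z.2 z.2.2
    have h2 : ‖(z.2 : E)‖ ≤ ‖(z.1 : E) + z.2‖ + ‖(z.1 : E)‖ := by
      simpa using norm_sub_le ((z.1 : E) + z.2) z.1
    have h3 : T z = (z.1 : E) + z.2 := rfl
    rw [h3, Prod.norm_def]
    simp only [Submodule.coe_norm, NNReal.coe_ofNat]
    refine max_le ?_ ?_ <;> linarith [norm_nonneg ((z.1 : E) + z.2)]
  have h1 := hT.isClosed_range T.uniformContinuous
  convert h1 using 1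
  ext x
  simp only [SetLike.mem_coe, Submodule.mem_sup, Set.mem_range]
  exact ⟨fun ⟨y, hy, z, hz, hx⟩ => ⟨(⟨y, hy⟩, ⟨z, hz⟩), hx⟩,
    fun ⟨z, hz⟩ => ⟨z.1, z.1.2, z.2, z.2.2, hz⟩⟩

/-- The ⋆-homomorphic projection onto `B` along the ideal `I`. -/
theorem exists_projection (hB : IsClosed (B : Set A)) (hI : IsClosed (I : Set A))
    (hBI : ∀ b ∈ B, ∀ x ∈ I, b * x ∈ I) (h : ∀ b ∈ B, ∀ x ∈ I, ‖b‖ ≤ ‖b + x‖)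
    (hdense : Dense ((B.toNonUnitalSubalgebra.toSubmodule ⊔ I.toNonUnitalSubalgebra.toSubmodule :
      Submodule ℂ A) : Set A)) :
    ∃ P : A →⋆ₙₐ[ℂ] A, (∀ a, P a ∈ B) ∧ (∀ b ∈ B, P b = b) ∧ ∀ x ∈ I, P x = 0 := by
  set p := B.toNonUnitalSubalgebra.toSubmodule
  set q := I.toNonUnitalSubalgebra.toSubmodule
  have hcl := isClosed_sup_of_norm_le (p := p) (q := q) hB hI h
  -- The estimate at `y = -x` gives a trivial intersection; the sum is both closed and dense, so it
  -- is everything.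
  have hc : IsCompl p q := by
    refine ⟨Submodule.disjoint_def.2 fun x hx hy => ?_, codisjoint_iff.2 ?_⟩
    · have := h x hx (-x) (neg_mem hy)
      rw [add_neg_cancel, norm_zero] at this
      exact norm_le_zero_iff.1 this
    · refine SetLike.coe_injective ?_
      rw [← hcl.closure_eq, hdense.closure_eq]; rfl
  have hIB : ∀ x ∈ I, ∀ b ∈ B, x * b ∈ I := fun x hx b hb => by
    have := star_mem (hBI _ (star_mem hb) _ (star_mem hx))
    rwa [star_mul, star_star, star_star] at this
  let P := p.projection q hc
  have hP1 : ∀ b ∈ B, P b = b := fun b hb =>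
    congrArg Subtype.val (Submodule.projectionOnto_apply_left hc ⟨b, hb⟩)
  have hP2 : ∀ x ∈ I, P x = 0 := fun x hx => by
    have := congrArg Subtype.val (Submodule.projectionOnto_apply_right hc ⟨x, hx⟩)
    exact this
  have hdec : ∀ a, ∃ b ∈ B, ∃ x ∈ I, a = b + x := fun a => by
    obtain ⟨b, hb, x, hx, h⟩ := Submodule.mem_sup.1
      (show a ∈ p ⊔ q by rw [hc.sup_eq_top]; trivial)
    exact ⟨b, hb, x, hx, h.symm⟩
  have hP3 : ∀ b ∈ B, ∀ x ∈ I, P (b + x) = b := fun b hb x hx => by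
    rw [map_add, hP1 b hb, hP2 x hx, add_zero]
  refine ⟨{ toFun := P, map_zero' := map_zero P, map_add' := map_add P, map_smul' := map_smul P,
            map_mul' := fun a a' => ?_, map_star' := fun a => ?_ }, fun a => ?_, hP1, hP2⟩
  -- Multiplicativity: every term of `(b + x) * (c + y)` other than `b * c` lies in `I`.
  · obtain ⟨b, hb, x, hx, rfl⟩ := hdec a
    obtain ⟨c, hc, y, hy, rfl⟩ := hdec a'
    rw [hP3 b hb x hx, hP3 c hc y hy,
      show (b + x) * (c + y) = b * c + (b * y + x * c + x * y) by noncomm_ring]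
    exact hP3 _ (mul_mem hb hc) _
      (add_mem (add_mem (hBI b hb y hy) (hIB x hx c hc)) (mul_mem hx hy))
  · obtain ⟨b, hb, x, hx, rfl⟩ := hdec a
    rw [star_add, hP3 b hb x hx]
    exact hP3 _ (star_mem hb) _ (star_mem hx)
  · obtain ⟨b, hb, x, hx, rfl⟩ := hdec a
    change P (b + x) ∈ B
    rwa [hP3 b hb x hx]

end Quotient

/-- Each element of the closure is the infimum of one of the finitely many nonempty subsets of `s`.
Any finite set of indices thus sits in a finite inf-closed one, to which
`IsCStarGrading.isClosed_part` applies. -/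
theorem finite_infClosure {L : Type*} [SemilatticeInf L] {s : Set L} (hs : s.Finite) :
    (infClosure s).Finite := by
  classical
  refine ((hs.toFinset.powerset.finite_toSet).biUnion (t := fun t =>
    {a | ∃ h : t.Nonempty, t.inf' h id = a}) fun t _ => ?_).subset ?_
  · exact Set.Subsingleton.finite fun a ⟨_, ha⟩ b ⟨_, hb⟩ => ha.symm.trans hb
  · rintro a ⟨t, ht, hts, rfl⟩
    refine Set.mem_biUnion (x := t) ?_ ⟨ht, rfl⟩
    simpa [Finset.subset_iff] using hts

/-! ### Partial sums of a grading and the projections onto the indices above `i` -/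

namespace IsCStarGrading

variable {L : Type w} {A : Type u} [NonUnitalCStarAlgebra A]
  {S : L → NonUnitalStarSubalgebra ℂ A}

/-- The sum of the components with index in `F`. -/
def part (S : L → NonUnitalStarSubalgebra ℂ A) (F : Set L) : Submodule ℂ A :=
  ⨆ j ∈ F, (S j).toNonUnitalSubalgebra.toSubmodule

theorem mem_part {F : Set L} {j : L} (hj : j ∈ F) {a : A} (ha : a ∈ S j) : a ∈ part S F :=
  (le_iSup₂_of_le (f := fun j (_ : j ∈ F) => (S j).toNonUnitalSubalgebra.toSubmodule)
    j hj le_rfl) ha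

theorem part_mono {F F' : Set L} (h : F ⊆ F') : part S F ≤ part S F' :=
  biSup_mono h

theorem part_union (F F' : Set L) : part S (F ∪ F') = part S F ⊔ part S F' := iSup_union

theorem part_induction {F : Set L} {motive : A → Prop} {a : A} (ha : a ∈ part S F)
    (mem : ∀ j ∈ F, ∀ a ∈ S j, motive a) (zero : motive 0)
    (add : ∀ a b, motive a → motive b → motive (a + b)) : motive a := by
  rw [part, iSup_subtype'] at ha
  exact Submodule.iSup_induction _ (motive := motive) ha (fun j a ha => mem j j.2 a ha) zero add

theorem part_star_mem {F : Set L} {a : A} (ha : a ∈ part S F) : star a ∈ part S F :=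
  part_induction (motive := fun a => star a ∈ part S F) ha
    (fun j hj a ha => mem_part hj (star_mem ha))
    (by rw [star_zero]; exact zero_mem _) fun a b ha hb => by rw [star_add]; exact add_mem ha hb

theorem exists_finset_mem_part {F : Set L} {a : A} (ha : a ∈ part S F) :
    ∃ s : Finset L, (s : Set L) ⊆ F ∧ a ∈ part S (s : Set L) := by
  classical
  refine part_induction (motive := fun a => ∃ s : Finset L, (s : Set L) ⊆ F ∧
    a ∈ part S (s : Set L)) ha (fun j hj a ha => ⟨{j}, by simpa using hj, mem_part (by simp) ha⟩)
    ⟨∅, by simp, zero_mem _⟩ ?_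
  rintro a b ⟨s, hs, ha⟩ ⟨t, ht, hb⟩
  exact ⟨s ∪ t, by simp [hs, ht], add_mem (part_mono (by simp) ha) (part_mono (by simp) hb)⟩

variable [SemilatticeInf L]

theorem part_mul_mem (hS : IsCStarGrading S) {F F' F'' : Set L}
    (h : ∀ j ∈ F, ∀ k ∈ F', j ⊓ k ∈ F'') {a b : A} (ha : a ∈ part S F) (hb : b ∈ part S F') :
    a * b ∈ part S F'' := by
  refine part_induction (motive := fun a => a * b ∈ part S F'') ha
    (fun j hj a ha => ?_) (by rw [zero_mul]; exact zero_mem _)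
    fun a a' ha ha' => by rw [add_mul]; exact add_mem ha ha'
  refine part_induction (motive := fun b => a * b ∈ part S F'') hb
    (fun k hk b hb => ?_) (by rw [mul_zero]; exact zero_mem _)
    fun b b' hb hb' => by rw [mul_add]; exact add_mem hb hb'
  exact mem_part (h j hj k hk) (hS.mul_mem j k a ha b hb)

/-- The ⋆-subalgebra formed by the components with index in an inf-closed set `F`. -/
def subalgebra (hS : IsCStarGrading S) (F : Set L) (hF : InfClosed F) :
    NonUnitalStarSubalgebra ℂ A where
  toSubmodule := part S F
  mul_mem' ha hb := hS.part_mul_mem (fun _ hj _ hk => hF hj hk) ha hb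
  star_mem' ha := part_star_mem ha

theorem disjoint_part (hS : IsCStarGrading S) {F F' : Set L} (h : Disjoint F F') :
    Disjoint (part S F) (part S F') :=
  hS.independent.disjoint_biSup_biSup h

/-- Induction removing a maximal index `k`. By maximality an infimum involving another index of `F`
is never `k`, so the remaining indices are still inf-closed and `S k` multiplies their sum into
itself. Independence makes the two summands disjoint, whence the projection onto `S k` is
contractive and the sum of the two closed subspaces is closed. -/
theorem isClosed_part (hS : IsCStarGrading S) (F : Finset L) (hF : InfClosed (F : Set L)) :
    IsClosed (part S (F : Set L) : Set A) := by
  classical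
  induction F using Finset.strongInduction with
  | H F ih =>
    rcases F.eq_empty_or_nonempty with rfl | hne
    · simp [part]
    obtain ⟨k, hk⟩ := F.exists_maximal hne
    have hmax : ∀ j ∈ F, k ≤ j → j = k := fun j hj hkj => le_antisymm (hk.2 hj hkj) hkj
    have hF' : InfClosed ((F.erase k : Finset L) : Set L) := fun i hi j hj => by
      simp only [Finset.coe_erase, Set.mem_sdiff, Finset.mem_coe, Set.mem_singleton_iff] at hi hj ⊢
      refine ⟨hF hi.1 hj.1, fun h => hi.2 (hmax i hi.1 ?_)⟩
      rw [← h]; exact inf_le_left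
    have hI := ih _ (Finset.erase_ssubset hk.1) hF'
    have hcl := isClosed_sup_of_norm_le (p := (S k).toNonUnitalSubalgebra.toSubmodule)
      (q := part S ((F.erase k : Finset L) : Set L)) (hS.isClosed k) hI fun b hb x hx => by
        refine norm_le_norm_add_of_disjoint (B := S k) (I := hS.subalgebra _ hF') (hS.isClosed k) hI
          (fun b hb x hx => ?_) (fun a ha ha' => ?_) hb hx
        · refine hS.part_mul_mem (F := {k}) (F' := ((F.erase k : Finset L) : Set L))
            (F'' := ((F.erase k : Finset L) : Set L)) (fun i hi j hj => ?_) (mem_part (Set.mem_singleton k) hb) hx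
          obtain rfl : i = k := hi
          simp only [Finset.coe_erase, Set.mem_sdiff, Finset.mem_coe,
            Set.mem_singleton_iff] at hj ⊢
          refine ⟨hF hk.1 hj.1, fun h => hj.2 (hmax j hj.1 ?_)⟩
          rw [← h]; exact inf_le_right
        · exact Submodule.disjoint_def.1 (hS.disjoint_part (F := {k})
            (F' := ((F.erase k : Finset L) : Set L)) (by simp)) a (mem_part (Set.mem_singleton k) ha) ha'
    have : part S (F : Set L) = (S k).toNonUnitalSubalgebra.toSubmodule ⊔
        part S ((F.erase k : Finset L) : Set L) := by
      conv_lhs => rw [← Finset.insert_erase hk.1, Finset.coe_insert, Set.insert_eq, part_union]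
      simp [part]
    rwa [this]

theorem infClosed_ge (i : L) : InfClosed {j | i ≤ j} := fun _ hj _ hk => le_inf hj hk

theorem infClosed_not_ge (i : L) : InfClosed {j | ¬ i ≤ j} :=
  fun _ hj _ _ h => hj (h.trans inf_le_left)

/-- Both elements involve finitely many components. Inside the finite inf-closure `K` of these
indices, the parts above and not above `i` are each inf-closed, hence give closed subalgebras; the
second absorbs the first because `j ⊓ k ≤ k`, and independence makes them disjoint. -/
theorem norm_le_norm_add (hS : IsCStarGrading S) (i : L) {b x : A}
    (hb : b ∈ part S {j | i ≤ j}) (hx : x ∈ part S {j | ¬ i ≤ j}) : ‖b‖ ≤ ‖b + x‖ := by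
  classical
  obtain ⟨s, hs, hb⟩ := exists_finset_mem_part hb
  obtain ⟨t, ht, hx⟩ := exists_finset_mem_part hx
  have hfin : (infClosure ((s : Set L) ∪ t)).Finite :=
    finite_infClosure (s.finite_toSet.union t.finite_toSet)
  set K := infClosure ((s : Set L) ∪ t)
  have hK : InfClosed K := infClosed_infClosure
  have hM : InfClosed (K ∩ {j | i ≤ j}) := hK.inter (infClosed_ge i)
  have hN : InfClosed (K ∩ {j | ¬ i ≤ j}) := hK.inter (infClosed_not_ge i)
  have hcl : ∀ F : Set L, F.Finite → InfClosed F → IsClosed (part S F : Set A) := by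
    intro F hF hF'
    lift F to Finset L using hF
    exact hS.isClosed_part F hF'
  refine norm_le_norm_add_of_disjoint (B := hS.subalgebra _ hM) (I := hS.subalgebra _ hN)
    (hcl _ (hfin.inter_of_left _) hM) (hcl _ (hfin.inter_of_left _) hN) (fun b hb x hx => ?_)
    (fun a ha ha' => ?_) ?_ ?_
  · exact hS.part_mul_mem (F := K ∩ {j | i ≤ j}) (F' := K ∩ {j | ¬ i ≤ j})
      (F'' := K ∩ {j | ¬ i ≤ j})
      (fun j hj k hk => ⟨hK hj.1 hk.1, fun h => hk.2 (h.trans inf_le_right)⟩) hb hx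
  · refine Submodule.disjoint_def.1 (hS.disjoint_part ?_) a ha ha'
    exact Set.disjoint_left.2 fun j hj hj' => hj'.2 hj.2
  · exact part_mono (Set.subset_inter (Set.subset_union_left.trans subset_infClosure) hs) hb
  · exact part_mono (Set.subset_inter (Set.subset_union_right.trans subset_infClosure) ht) hx

/-- The ⋆-homomorphism `P i` that is the identity on `S j` for `i ≤ j` and vanishes on the other
components. -/
theorem exists_hom (hS : IsCStarGrading S) (i : L) : ∃ P : A →⋆ₙₐ[ℂ] A,
    (∀ j, i ≤ j → ∀ a ∈ S j, P a = a) ∧ (∀ j, ¬ i ≤ j → ∀ a ∈ S j, P a = 0) ∧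
      ∀ a, ∀ x ∈ S i, P a * x ∈ S i := by
  set B := (hS.subalgebra _ (infClosed_ge i)).topologicalClosure
  set I := (hS.subalgebra _ (infClosed_not_ge i)).topologicalClosure
  have hB : ∀ j, i ≤ j → ∀ a ∈ S j, a ∈ B := fun j hj a ha =>
    NonUnitalStarSubalgebra.le_topologicalClosure _ (mem_part (F := {j | i ≤ j}) hj ha)
  have hI : ∀ j, ¬ i ≤ j → ∀ a ∈ S j, a ∈ I := fun j hj a ha =>
    NonUnitalStarSubalgebra.le_topologicalClosure _ (mem_part (F := {j | ¬ i ≤ j}) hj ha)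
  -- The estimate is a closed condition on the pair, so it passes from the algebraic sums to their
  -- closures.
  have key : ∀ b ∈ B, ∀ x ∈ I, ‖b‖ ≤ ‖b + x‖ := fun b hb x hx =>
    map_mem_closure₂ (f := fun b x => (b, x)) (u := {q : A × A | ‖q.1‖ ≤ ‖q.1 + q.2‖})
      (by fun_prop) hb hx (fun b hb x hx => hS.norm_le_norm_add i hb hx) |>
      (isClosed_le (by fun_prop) (by fun_prop)).closure_subset
  have hle : (⨆ j, (S j).toNonUnitalSubalgebra.toSubmodule) ≤
      B.toNonUnitalSubalgebra.toSubmodule ⊔ I.toNonUnitalSubalgebra.toSubmodule := by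
    refine iSup_le fun j a ha => ?_
    by_cases hj : i ≤ j
    · exact Submodule.mem_sup_left (hB j hj a ha)
    · exact Submodule.mem_sup_right (hI j hj a ha)
  obtain ⟨P, hP, hP1, hP2⟩ := exists_projection (B := B) (I := I) isClosed_closure isClosed_closure
    (fun b hb x hx => map_mem_closure₂ continuous_mul hb hx fun b hb x hx =>
      hS.part_mul_mem (F := {j | i ≤ j}) (F' := {j | ¬ i ≤ j}) (F'' := {j | ¬ i ≤ j})
        (fun j hj k hk h => hk (h.trans inf_le_right)) hb hx) key
    (hS.total.mono (SetLike.coe_subset_coe.2 hle))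
  refine ⟨P, fun j hj a ha => hP1 a (hB j hj a ha), fun j hj a ha => hP2 a (hI j hj a ha),
    fun a x hx => ?_⟩
  -- The values of `P` are limits of sums of elements of `S j` with `i ≤ j`, and for these `S j * S
  -- i ⊆ S (j ⊓ i) = S i`.
  have h1 : P a * x ∈ closure (S i : Set A) :=
    map_mem_closure (f := fun b => b * x) (by fun_prop) (hP a) fun b hb => by
      refine part_induction (motive := fun b => b * x ∈ S i) hb (fun j hj b hb => ?_) (by rw [zero_mul]; exact zero_mem _)
        fun a a' ha ha' => by rw [add_mul]; exact add_mem ha ha'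
      have := hS.mul_mem j i b hb x hx
      rwa [inf_eq_right.2 hj] at this
  rwa [(hS.isClosed i).closure_eq] at h1

/-- On each component `P` is either the identity or zero, so it commutes with any `φ` preserving the
components; totality and continuity do the rest. It is used with `φ` an automorphism of the action.
-/
theorem hom_equivariant (hS : IsCStarGrading S) {i : L} {P : A →⋆ₙₐ[ℂ] A}
    (hP1 : ∀ j, i ≤ j → ∀ a ∈ S j, P a = a) (hP2 : ∀ j, ¬ i ≤ j → ∀ a ∈ S j, P a = 0)
    {φ : A →⋆ₙₐ[ℂ] A} (hφ : ∀ i, ∀ a ∈ S i, φ a ∈ S i) (a : A) : P (φ a) = φ (P a) := by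
  have hc : ∀ ψ : A →⋆ₙₐ[ℂ] A, Continuous ψ := fun ψ =>
    AddMonoidHomClass.continuous_of_bound ψ 1
      fun a => by simpa using NonUnitalStarAlgHom.norm_apply_le ψ a
  refine hS.total.induction (P := fun a => P (φ a) = φ (P a)) (fun a ha => ?_)
    (isClosed_eq ((hc P).comp (hc φ)) ((hc φ).comp (hc P))) a
  refine Submodule.iSup_induction _ (motive := fun a => P (φ a) = φ (P a)) ha (fun j a ha => ?_)
    (by simp) fun a b ha hb => by simp only [map_add, ha, hb]
  by_cases hj : i ≤ j
  · rw [hP1 j hj a ha, hP1 j hj _ (hφ j a ha)]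
  · rw [hP2 j hj a ha, hP2 j hj _ (hφ j a ha), map_zero]

end IsCStarGrading

/-! ### Extending a representation of an ideal-like subalgebra -/

section Extension

variable {J : Type*} [NonUnitalCStarAlgebra J] {H : Type*} [NormedAddCommGroup H]
  [InnerProductSpace ℂ H] [CompleteSpace H] (π : J →⋆ₙₐ[ℂ] (H →L[ℂ] H))

theorem inner_rep_left (x : J) (h k : H) : inner ℂ (π x h) k = inner ℂ h (π (star x) k) := by
  rw [map_star, ContinuousLinearMap.star_eq_adjoint, ContinuousLinearMap.adjoint_inner_right]

/-- A closed subspace containing the range and the common kernel of a ⋆-representation is the whole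
space. -/
theorem eq_top_of_range_of_ker {M : Submodule ℂ H} (hM : IsClosed (M : Set H))
    (h1 : ∀ x k, π x k ∈ M) (h2 : ∀ h, (∀ x, π x h = 0) → h ∈ M) : M = ⊤ := by
  have : CompleteSpace M := hM.completeSpace_coe
  rw [← Submodule.orthogonal_eq_bot_iff, Submodule.eq_bot_iff]
  intro h hh
  -- A vector orthogonal to the range is killed by every `π x`; it then belongs to `M` as well as to
  -- its orthogonal complement.
  have h3 : h ∈ M := h2 h fun x => ext_inner_left ℂ fun k => by
    rw [inner_zero_right, ← star_star x, ← inner_rep_left]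
    exact (Submodule.mem_orthogonal _ _).1 hh _ (h1 _ k)
  exact inner_self_eq_zero.1 ((Submodule.mem_orthogonal _ _).1 hh h h3)

/-- The locus where two bounded operators agree is a closed subspace. Including the common kernel
among the test vectors is what allows degenerate representations. -/
theorem clm_ext_of_range_of_ker {F : Type*} [NormedAddCommGroup F] [NormedSpace ℂ F]
    {T T' : H →L[ℂ] F} (h1 : ∀ x k, T (π x k) = T' (π x k))
    (h2 : ∀ h, (∀ x, π x h = 0) → T h = T' h) : T = T' := by
  have := eq_top_of_range_of_ker π (M := LinearMap.eqLocus T.toLinearMap T'.toLinearMap)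
    (isClosed_eq T.continuous T'.continuous) h1 h2
  ext h
  exact show h ∈ LinearMap.eqLocus T.toLinearMap T'.toLinearMap by rw [this]; trivial

/-- A bounded net of operators converges strongly if it does so on the range and on the common
kernel of a ⋆-representation. -/
theorem exists_strong_limit {ι : Type*} {l : Filter ι} [l.NeBot] (V : ι → H →L[ℂ] H) {C : ℝ}
    (hC : ∀ᶠ e in l, ‖V e‖ ≤ C)
    (h1 : ∀ x k, ∃ y, Tendsto (fun e => V e (π x k)) l (𝓝 y))
    (h2 : ∀ h, (∀ x, π x h = 0) → ∃ y, Tendsto (fun e => V e h) l (𝓝 y)) :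
    ∃ T : H →L[ℂ] H, ∀ h, Tendsto (fun e => V e h) l (𝓝 (T h)) := by
  have hC0 : 0 ≤ C := by
    obtain ⟨e, he⟩ := hC.exists
    exact (norm_nonneg _).trans he
  let M : Submodule ℂ H :=
    { carrier := {h | ∃ y, Tendsto (fun e => V e h) l (𝓝 y)}
      zero_mem' := ⟨0, by simp⟩
      add_mem' := by
        rintro h k ⟨y, hy⟩ ⟨z, hz⟩
        exact ⟨y + z, by simpa using hy.add hz⟩
      smul_mem' := by
        rintro c h ⟨y, hy⟩
        exact ⟨c • y, by simpa using hy.const_smul c⟩ }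
  have hM : IsClosed (M : Set H) := by
    refine isClosed_of_closure_subset fun h hh => ?_
    refine cauchy_map_iff_exists_tendsto.1 (Metric.cauchy_iff.2 ⟨inferInstance, fun ε hε => ?_⟩)
    -- Replacing `h` by `k` costs at most `C * ‖h - k‖ ≤ ε / 4`, and convergence at `k` another `ε /
    -- 4`, so any two late values at `h` are within `ε`. The `C + 1` keeps the denominator positive
    -- when `C = 0`.
    obtain ⟨k, ⟨y, hy⟩, hk⟩ := Metric.mem_closure_iff.1 hh (ε / (4 * (C + 1))) (by positivity)
    rw [dist_eq_norm] at hk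
    have hy' := hy (Metric.ball_mem_nhds y (ε := ε / 4) (by positivity))
    refine ⟨_, image_mem_map (inter_mem hC hy'), ?_⟩
    have key : ∀ e, ‖V e‖ ≤ C → dist (V e k) y < ε / 4 → dist (V e h) y < ε / 2 := by
      intro e he he'
      have h3 : dist (V e h) (V e k) ≤ ε / 4 := by
        rw [dist_eq_norm, ← map_sub]
        refine ((V e).le_of_opNorm_le he _).trans ?_
        calc C * ‖h - k‖ ≤ (C + 1) * (ε / (4 * (C + 1))) :=
              mul_le_mul (by linarith) hk.le (norm_nonneg _) (by linarith)
          _ = ε / 4 := by field_simp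
      linarith [dist_triangle (V e h) (V e k) y]
    rintro _ ⟨e, ⟨he, he'⟩, rfl⟩ _ ⟨f, ⟨hf, hf'⟩, rfl⟩
    have := key e he he'
    have := key f hf hf'
    linarith [dist_triangle_right (V e h) (V f h) y]
  have htop := eq_top_of_range_of_ker π hM h1 h2
  have hex : ∀ h, ∃ y, Tendsto (fun e => V e h) l (𝓝 y) := fun h =>
    show h ∈ M by rw [htop]; trivial
  choose y hy using hex
  refine ⟨LinearMap.mkContinuous
    { toFun := y
      map_add' := fun h k => tendsto_nhds_unique (hy (h + k))
        (by simpa using (hy h).add (hy k))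
      map_smul' := fun c h => tendsto_nhds_unique (hy (c • h))
        (by simpa using (hy h).const_smul c) } C fun h => ?_, hy⟩
  exact le_of_tendsto (hy h).norm (hC.mono fun e he => (V e).le_of_opNorm_le he h)

/-- A representation `π` of a closed ⋆-subalgebra `J`, on which `A` acts by left multiplication
through the endomorphism `P`, extends to a representation of `A`. -/
theorem exists_extension {A : Type*} [NonUnitalCStarAlgebra A] (J : NonUnitalStarSubalgebra ℂ A)
    [IsClosed (J : Set A)] (P : A →⋆ₙₐ[ℂ] A) (hP : ∀ a, ∀ x ∈ J, P a * x ∈ J)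
    (π : J →⋆ₙₐ[ℂ] (H →L[ℂ] H)) :
    ∃ T : A →⋆ₙₐ[ℂ] (H →L[ℂ] H), (∀ a (x : J) k, T a (π x k) = π ⟨P a * x, hP a x x.2⟩ k) ∧
      ∀ a h, (∀ x, π x h = 0) → T a h = 0 := by
  obtain ⟨l, hl, hl1, -, hl2⟩ := exists_approximateUnit J inferInstance
  let m : A → J → J := fun a x => ⟨P a * x, hP a x x.2⟩
  have hπ : Continuous π := AddMonoidHomClass.continuous_of_bound π 1
    fun a => by simpa using NonUnitalStarAlgHom.norm_apply_le π a
  have hm : ∀ a, Continuous (m a) := fun a =>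
    (continuous_const.mul continuous_subtype_val).subtype_mk _
  -- The extension is to be the strong limit of `π (P a * e)` along the approximate unit. On the
  -- range of `π` this becomes `π (P a * (e * x))`, which converges; on the common kernel all terms
  -- vanish.
  have hlim : ∀ a x k, Tendsto (fun e => π (m a e) (π x k)) l (𝓝 (π (m a x) k)) := by
    intro a x k
    have h1 : Tendsto (fun e => π (m a (e * x)) k) l (𝓝 (π (m a x) k)) :=
      ((hπ.comp (hm a)).clm_apply continuous_const).continuousAt.tendsto.comp (hl2 x)
    refine h1.congr fun e => ?_
    have : m a (e * x) = m a e * x := Subtype.ext (mul_assoc _ _ _).symm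
    rw [this, map_mul]; rfl
  have hex : ∀ a, ∃ T : H →L[ℂ] H, ∀ h, Tendsto (fun e => π (m a e) h) l (𝓝 (T h)) := by
    intro a
    refine exists_strong_limit π (fun e => π (m a e)) (C := ‖a‖) (hl1.mono fun e he => ?_)
      (fun x k => ⟨_, hlim a x k⟩) fun h hh => ⟨0, by simpa only [hh] using tendsto_const_nhds⟩
    calc ‖π (m a e)‖ ≤ ‖m a e‖ := NonUnitalStarAlgHom.norm_apply_le π _
      _ ≤ ‖P a‖ * ‖(e : A)‖ := norm_mul_le (P a) (e : A)
      _ ≤ ‖a‖ * 1 := mul_le_mul (NonUnitalStarAlgHom.norm_apply_le P a) he.2.1 (norm_nonneg _)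
          (norm_nonneg _)
      _ = ‖a‖ := mul_one _
  choose T hT using hex
  have hT1 : ∀ a x k, T a (π x k) = π (m a x) k := fun a x k =>
    tendsto_nhds_unique (hT a _) (hlim a x k)
  have hT2 : ∀ a h, (∀ x, π x h = 0) → T a h = 0 := fun a h hh =>
    tendsto_nhds_unique (hT a h) (by simpa only [hh] using tendsto_const_nhds)
  refine ⟨{ toFun := T, map_smul' := fun c a => ?_, map_zero' := ?_, map_add' := fun a b => ?_,
            map_mul' := fun a b => ?_, map_star' := fun a => ?_ }, hT1, hT2⟩
  · refine clm_ext_of_range_of_ker π (fun x k => ?_) fun h hh => ?_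
    · have : m (c • a) x = c • m a x := Subtype.ext (by simp [m, smul_mul_assoc])
      rw [hT1, this, map_smul]
      simp [hT1]
    · rw [hT2 _ h hh]; simp [hT2 _ h hh]
  · refine clm_ext_of_range_of_ker π (fun x k => ?_) fun h hh => ?_
    · have : m 0 x = 0 := Subtype.ext (by simp [m])
      rw [hT1, this, map_zero]; rfl
    · rw [hT2 _ h hh]; rfl
  · refine clm_ext_of_range_of_ker π (fun x k => ?_) fun h hh => ?_
    · have : m (a + b) x = m a x + m b x := Subtype.ext (by simp [m, add_mul])
      rw [hT1, this, map_add]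
      simp [hT1]
    · rw [hT2 _ h hh]; simp [hT2 _ h hh]
  · refine clm_ext_of_range_of_ker π (fun x k => ?_) fun h hh => ?_
    · have : m (a * b) x = m a (m b x) := Subtype.ext (by simp [m, mul_assoc])
      rw [hT1, this, mul_apply_eq_comp, hT1, hT1]
    · rw [hT2 _ h hh, mul_apply_eq_comp, hT2 b h hh, map_zero]
  · refine clm_ext_of_range_of_ker π (fun x k => ?_) fun h hh => ?_
    · refine ext_inner_right ℂ fun h => ?_
      rw [ContinuousLinearMap.star_eq_adjoint, ContinuousLinearMap.adjoint_inner_left, hT1,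
        inner_rep_left, inner_rep_left]
      -- On the range, compatibility with the involution reduces to `(P a⋆ * x)⋆ * y = x⋆ * (P a *
      -- y)`.
      suffices h' : π (star (m (star a) x)) = (π (star x)).comp (T a) by rw [h']; rfl
      refine clm_ext_of_range_of_ker π (fun y k => ?_) fun h hh => ?_
      · have : star (m (star a) x) * y = star x * m a y :=
          Subtype.ext (by simp [m, mul_assoc, map_star])
        rw [ContinuousLinearMap.comp_apply, hT1, ← mul_apply_eq_comp, ← map_mul, this,
          map_mul]; rfl
      · rw [hh, ContinuousLinearMap.comp_apply, hT2 a h hh, map_zero]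
    · refine ext_inner_right ℂ fun k => ?_
      rw [ContinuousLinearMap.star_eq_adjoint, ContinuousLinearMap.adjoint_inner_left,
        hT2 _ h hh, inner_zero_left]
      -- For `h` in the common kernel the claim is that `T a` takes its values in the orthogonal
      -- complement of `h`.
      suffices h' : (innerSL ℂ h : H →L[ℂ] ℂ).comp (T a) = 0 from
        (DFunLike.congr_fun h' k).symm
      refine clm_ext_of_range_of_ker π (fun y k => ?_) fun k hk => ?_
      · change inner ℂ h (T a (π y k)) = 0
        rw [hT1, ← star_star (m a y), ← inner_rep_left, hh, inner_zero_left]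
      · change inner ℂ h (T a k) = 0
        rw [hT2 a k hk, inner_zero_right]

end Extension

/-! ### The crossed product norms restrict to the norms of the components -/

section InclusionNorm

variable {G : Type v} [Group G] [TopologicalSpace G] {A : Type u} [NonUnitalCStarAlgebra A]
  {α : CStarAction G A} {J : NonUnitalStarSubalgebra ℂ A} [IsClosed (J : Set A)]
  {P : A →⋆ₙₐ[ℂ] A}

/-- Since `P` fixes `J`, both sides send `π y k` to `π (x * y) k`, and both vanish on the common
kernel. -/
theorem extension_apply_eq {H : Type*} [NormedAddCommGroup H] [InnerProductSpace ℂ H]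
    [CompleteSpace H] (hP : ∀ a, ∀ x ∈ J, P a * x ∈ J) (hPJ : ∀ x ∈ J, P x = x)
    {π : J →⋆ₙₐ[ℂ] (H →L[ℂ] H)} {T : A →⋆ₙₐ[ℂ] (H →L[ℂ] H)}
    (hT1 : ∀ a (x : J) k, T a (π x k) = π ⟨P a * x, hP a x x.2⟩ k)
    (hT2 : ∀ a h, (∀ x, π x h = 0) → T a h = 0) :
    T.comp (NonUnitalStarSubalgebraClass.subtype J) = π := by
  ext1 x
  refine clm_ext_of_range_of_ker π (fun y k => ?_) fun h hh => ?_
  · have : (⟨P x * y, hP x y y.2⟩ : J) = x * y :=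
      Subtype.ext (congrArg (· * (y : A)) (hPJ x x.2))
    change T x (π y k) = _
    rw [hT1, this, map_mul]; rfl
  · rw [hh]; exact hT2 _ h hh

/-- Covariance of the extension, with `V` a unitary of the group, `θ` the automorphism of `J` and
`b` the translate of `a`. Surjectivity of `θ` ensures that `V` maps the common kernel into itself.
-/
theorem extension_intertwines {H : Type*} [NormedAddCommGroup H] [InnerProductSpace ℂ H]
    [CompleteSpace H] (hP : ∀ a, ∀ x ∈ J, P a * x ∈ J)
    {π : J →⋆ₙₐ[ℂ] (H →L[ℂ] H)} {T : A →⋆ₙₐ[ℂ] (H →L[ℂ] H)}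
    (hT1 : ∀ a (x : J) k, T a (π x k) = π ⟨P a * x, hP a x x.2⟩ k)
    (hT2 : ∀ a h, (∀ x, π x h = 0) → T a h = 0) {V : H →L[ℂ] H} {θ : J → J} (hθ : Surjective θ)
    (hV : ∀ x h, π (θ x) (V h) = V (π x h)) {a b : A}
    (hab : ∀ x : J, P b * θ x = θ ⟨P a * x, hP a x x.2⟩) : T b * V = V * T a := by
  refine clm_ext_of_range_of_ker π (fun x k => ?_) fun h hh => ?_
  · have h1 : (⟨P b * θ x, hP b _ (θ x).2⟩ : J) = θ ⟨P a * x, hP a x x.2⟩ := Subtype.ext (hab x)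
    rw [mul_apply_eq_comp, mul_apply_eq_comp, hT1, ← hV, ← hV, hT1, h1]
  · rw [mul_apply_eq_comp, mul_apply_eq_comp, hT2 a h hh, map_zero]
    refine hT2 b _ fun x => ?_
    obtain ⟨y, rfl⟩ := hθ x
    rw [hV, hh, map_zero]

theorem exists_hilbertRep_comp_eq (hP : ∀ a, ∀ x ∈ J, P a * x ∈ J) (hPJ : ∀ x ∈ J, P x = x)
    (ρ : HilbertRep.{u, w} J) :
    ∃ ρ' : HilbertRep.{u, w} A, ρ'.comp (NonUnitalStarSubalgebraClass.subtype J) = ρ := by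
  obtain ⟨T, hT1, hT2⟩ := exists_extension J P hP ρ.π
  refine ⟨{ H := ρ.H, π := T }, ?_⟩
  exact congrArg (fun π => ({ H := ρ.H, π := π } : HilbertRep.{u, w} J))
    (extension_apply_eq hP hPJ hT1 hT2)

theorem CovariantRep.mk_eq_of_eq (R : CovariantRep α) {π : A →⋆ₙₐ[ℂ] (R.H →L[ℂ] R.H)}
    (h : π = R.π) (hc : ∀ (s : G) (a : A),
      π (α s a) = (R.U s : R.H →L[ℂ] R.H) * π a * star (R.U s : R.H →L[ℂ] R.H)) :
    ({ H := R.H, π := π, U := R.U, continuous_U := R.continuous_U, covariant := hc } :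
      CovariantRep α) = R := by
  subst h
  rfl

/-- Only the representation of the algebra has to be extended: the Hilbert space and the unitaries
are kept, and equivariance of `P` gives the covariance relation. -/
theorem exists_covariantRep_comp_eq (hJ : ∀ g, ∀ a ∈ J, α g a ∈ J)
    (hP : ∀ a, ∀ x ∈ J, P a * x ∈ J) (hPJ : ∀ x ∈ J, P x = x)
    (hPα : ∀ s a, P (α s a) = α s (P a)) (R : CovariantRep (α.restrict J hJ)) :
    ∃ R' : CovariantRep α, R'.comp (NonUnitalStarSubalgebraClass.subtype J) (fun _ _ => rfl) = R := by
  obtain ⟨T, hT1, hT2⟩ := exists_extension J P hP R.π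
  have hcov : ∀ (s : G) (a : A), T (α s a) * (R.U s : R.H →L[ℂ] R.H) =
      (R.U s : R.H →L[ℂ] R.H) * T a := by
    intro s a
    refine extension_intertwines hP hT1 hT2 (θ := α.restrict J hJ s)
      (α.restrict J hJ s).surjective (R.covariant_apply s) fun x => ?_
    change P (α s a) * α s x = α s (P a * x)
    rw [hPα, map_mul]
  refine ⟨{ H := R.H, π := T, U := R.U, continuous_U := R.continuous_U, covariant := fun s a => ?_ },
    ?_⟩
  · have hu : (R.U s : R.H →L[ℂ] R.H) * star (R.U s : R.H →L[ℂ] R.H) = 1 :=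
      Unitary.coe_mul_star_self (R.U s)
    rw [← hcov, mul_assoc, hu, mul_one]
  · exact R.mk_eq_of_eq (extension_apply_eq hP hPJ hT1 hT2) _

variable [IsTopologicalGroup G] [LocallyCompactSpace G] [MeasurableSpace G] [BorelSpace G]
  (μ : Measure G) [μ.IsHaarMeasure]

/-- Restricting covariant representations gives one inequality. The other holds because every
covariant representation of `J` is such a restriction, so the two suprema run over the same
operators. -/
theorem fullNorm_inclusion (hJ : ∀ g, ∀ a ∈ J, α g a ∈ J)
    (hP : ∀ a, ∀ x ∈ J, P a * x ∈ J) (hPJ : ∀ x ∈ J, P x = x)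
    (hPα : ∀ s a, P (α s a) = α s (P a)) (f : ConvAlg (α.restrict J hJ) μ) :
    (fullNorm α μ).toFun (ConvAlg.map μ (NonUnitalStarSubalgebraClass.subtype J)
      (fun _ _ => rfl) f) = (fullNorm (α.restrict J hJ) μ).toFun f := by
  refine le_antisymm (fullNorm_map_le μ _ _ f) (ciSup_le fun R => ?_)
  obtain ⟨R', rfl⟩ := exists_covariantRep_comp_eq hJ hP hPJ hPα R
  exact le_ciSup (f := fun R : CovariantRep α => ‖R.integrated (ConvAlg.map μ
    (NonUnitalStarSubalgebraClass.subtype J) (fun _ _ => rfl) f)‖)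
    ⟨_, by rintro _ ⟨R, rfl⟩; exact R.norm_integrated_le _⟩ R'

/-- A regular representation is determined by a representation `ρ` of the algebra alone, so
extending `ρ` suffices and no equivariance of `P` enters. -/
theorem reducedNorm_inclusion [μ.InnerRegularCompactLTTop] (hJ : ∀ g, ∀ a ∈ J, α g a ∈ J)
    (hP : ∀ a, ∀ x ∈ J, P a * x ∈ J) (hPJ : ∀ x ∈ J, P x = x)
    (f : ConvAlg (α.restrict J hJ) μ) :
    (reducedNorm α μ).toFun (ConvAlg.map μ (NonUnitalStarSubalgebraClass.subtype J)
      (fun _ _ => rfl) f) = (reducedNorm (α.restrict J hJ) μ).toFun f := by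
  refine le_antisymm (reducedNorm_map_le μ _ _ f) (ciSup_le fun ρ => ?_)
  obtain ⟨ρ', rfl⟩ := exists_hilbertRep_comp_eq hP hPJ ρ
  rw [← norm_regular_integrated_map μ (β := α) (NonUnitalStarSubalgebraClass.subtype J)
    (fun _ _ => rfl) ρ' f]
  exact le_ciSup (f := fun ρ : HilbertRep.{u, max u v} A =>
    ‖(CovariantRep.regular μ α ρ).integrated (ConvAlg.map μ
      (NonUnitalStarSubalgebraClass.subtype J) (fun _ _ => rfl) f)‖)
    ⟨_, by rintro _ ⟨R, rfl⟩; exact CovariantRep.norm_integrated_le _ _⟩ ρ'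

theorem fullNorm_le (f : ConvAlg α μ) : (fullNorm α μ).toFun f ≤ ∫ s, ‖f s‖ ∂μ :=
  ciSup_le fun R => R.norm_integrated_le f

theorem reducedNorm_le [μ.InnerRegularCompactLTTop] (f : ConvAlg α μ) :
    (reducedNorm α μ).toFun f ≤ ∫ s, ‖f s‖ ∂μ :=
  ciSup_le fun _ => CovariantRep.norm_integrated_le _ f

end InclusionNorm

/-! ### Morphisms of completions, independence from projections, integrals in closed subspaces -/

namespace CStarSeminorm

variable {R S : Type u} [NonUnitalRing R] [StarRing R] [Module ℂ R] [NonUnitalRing S] [StarRing S]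
  [Module ℂ S] {p : CStarSeminorm R} {q : CStarSeminorm S} {φ : R →⋆ₙₐ[ℂ] S}

theorem mapCompletion_coe (h : ∀ x, q.toFun (φ x) ≤ p.toFun x) (x : p.Pre) :
    mapCompletion p q φ h (x : p.Completion) = (preMap p q φ x : q.Completion) :=
  UniformSpace.Completion.map_coe (uniformContinuous_preMap p q φ h) x

theorem continuous_mapCompletion (h : ∀ x, q.toFun (φ x) ≤ p.toFun x) :
    Continuous (mapCompletion p q φ h) := UniformSpace.Completion.continuous_map

theorem norm_mapCompletion (h : ∀ x, q.toFun (φ x) = p.toFun x) (x : p.Completion) :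
    ‖mapCompletion p q φ (fun x => (h x).le) x‖ = ‖x‖ := by
  induction x using UniformSpace.Completion.induction_on with
  | hp => exact isClosed_eq (continuous_mapCompletion _).norm continuous_norm
  | ih x =>
    rw [mapCompletion_coe, UniformSpace.Completion.norm_coe, UniformSpace.Completion.norm_coe]
    exact h x

theorem isometry_mapCompletion (h : ∀ x, q.toFun (φ x) = p.toFun x) :
    Isometry (mapCompletion p q φ fun x => (h x).le) :=
  AddMonoidHomClass.isometry_of_norm _ (norm_mapCompletion h)

end CStarSeminorm

/-- Submodules indexed by a partial order are independent if for each `i` some additive map is the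
identity on the components above `i` and vanishes on the others. -/
theorem iSupIndep_of_projections {L : Type*} [PartialOrder L] {X : Type*} [AddCommGroup X]
    [Module ℂ X] {V : L → Submodule ℂ X} (Q : L → X →+ X)
    (h1 : ∀ i j, i ≤ j → ∀ x ∈ V j, Q i x = x) (h2 : ∀ i j, ¬ i ≤ j → ∀ x ∈ V j, Q i x = 0) :
    iSupIndep V := by
  classical
  refine iSupIndep_of_dfinsupp_lsum_injective V
    ((injective_iff_map_eq_zero _).2 fun m hm => ?_)
  by_contra hne
  obtain ⟨k, hk⟩ := m.support.exists_maximal (Finset.nonempty_iff_ne_empty.2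
    (mt DFinsupp.support_eq_empty.1 hne))
  -- At a maximal index `k` of the support, no other index lies above `k`, so `Q k` isolates the
  -- term `m k` of the vanishing sum.
  have h3 : Q k (∑ j ∈ m.support, (m j : X)) = m k := by
    rw [map_sum, Finset.sum_eq_single_of_mem k hk.1, h1 k k le_rfl _ (m k).2]
    intro j hj hjk
    exact h2 k j (fun h => hjk (le_antisymm (hk.2 hj h) h)) _ (m j).2
  have h4 : ∑ j ∈ m.support, (m j : X) = 0 := by
    rw [← hm, DFinsupp.lsum_apply_apply, DFinsupp.sumAddHom_apply]; rfl
  rw [h4, map_zero] at h3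
  exact (DFinsupp.mem_support_iff.1 hk.1) (Subtype.ext h3.symm)

theorem integral_mem_of_isClosed {X : Type*} [MeasurableSpace X] [TopologicalSpace X]
    [OpensMeasurableSpace X] [R1Space X] {ν : Measure X} [IsFiniteMeasureOnCompacts ν] {E : Type*}
    [NormedAddCommGroup E] [NormedSpace ℂ E] [CompleteSpace E] {p : Submodule ℂ E}
    (hp : IsClosed (p : Set E)) {F : X → E} (hF : Continuous F) (hFs : HasCompactSupport F)
    (hFp : ∀ x, F x ∈ p) : ∫ x, F x ∂ν ∈ p := by
  have := hp.completeSpace_coe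
  let F' : X → p := fun x => ⟨F x, hFp x⟩
  have hF' : Integrable F' ν := (hF.subtype_mk hFp).integrable_of_hasCompactSupport
    (HasCompactSupport.intro hFs fun x hx => Subtype.ext
      (show F x = 0 from image_eq_zero_of_notMem_tsupport hx))
  rw [show ∫ x, F x ∂ν = p.subtypeL (∫ x, F' x ∂ν) from p.subtypeL.integral_comp_comm hF']
  exact (∫ x, F' x ∂ν).2

/-! ### Approximation of `C_c(G, A)` by elementary functions in the norm of L¹ -/

section Approximation

variable {G : Type v} [Group G] [TopologicalSpace G] [MeasurableSpace G] {A : Type u}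
  [NonUnitalCStarAlgebra A] {α : CStarAction G A} {μ : Measure G}

namespace ConvAlg

theorem sub_apply (f g : ConvAlg α μ) (s : G) : (f - g) s = f s - g s := rfl

theorem sum_apply {ι : Type*} (t : Finset ι) (f : ι → ConvAlg α μ) (s : G) :
    (∑ i ∈ t, f i) s = ∑ i ∈ t, f i s := by
  classical
  induction t using Finset.induction_on with
  | empty => simp [zero_apply]
  | insert i t hi ih => rw [Finset.sum_insert hi, Finset.sum_insert hi, add_apply, ih]

variable [IsTopologicalGroup G]

/-- The elementary function `s ↦ φ s • a` of `C_c(G, A)`. -/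
def tensor (φ : C(G, ℝ)) (hφ : HasCompactSupport φ) (a : A) : ConvAlg α μ :=
  mk (fun s => (φ s : ℂ) • a)
    ((Complex.continuous_ofReal.comp φ.continuous).smul continuous_const)
    (HasCompactSupport.intro hφ fun s hs => by
      rw [image_eq_zero_of_notMem_tsupport hs, Complex.ofReal_zero, zero_smul])

variable [LocallyCompactSpace G] [BorelSpace G] [μ.IsHaarMeasure]

/-- A subspace of `C_c(G, A)` containing the elementary functions with values in a dense set is
dense for the norm of `L¹`. -/
theorem exists_integral_norm_sub_lt [T2Space G] {D : Set A} (hD : Dense D)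
    {N : Submodule ℂ (ConvAlg α μ)}
    (hN : ∀ (φ : C(G, ℝ)) (hφ : HasCompactSupport φ), ∀ a ∈ D, tensor φ hφ a ∈ N)
    (f : ConvAlg α μ) {ε : ℝ} (hε : 0 < ε) : ∃ g ∈ N, ∫ s, ‖(f - g) s‖ ∂μ < ε := by
  obtain ⟨K', hK', hKK'⟩ := exists_compact_superset f.isCompact_tsupport
  -- The error will be at most `δ` and vanish off `K'`, so its integral is at most `δ * μ K' < ε`;
  -- the `+ 1` covers a null `K'`, and the `2` leaves room for strictness.
  set δ : ℝ := ε / (2 * (μ.real K' + 1)) with hδ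
  have hμ : 0 ≤ μ.real K' := measureReal_nonneg
  have hδ0 : 0 < δ := by positivity
  have hcov : tsupport f ⊆ ⋃ a ∈ D, {s | s ∈ interior K' ∧ ‖f s - a‖ < δ} := fun s hs => by
    obtain ⟨a, ha, hsa⟩ := Metric.mem_closure_iff.1 (hD (f s)) δ hδ0
    rw [dist_eq_norm] at hsa
    exact Set.mem_biUnion ha ⟨hKK' hs, hsa⟩
  have hopen : ∀ a, IsOpen {s | s ∈ interior K' ∧ ‖f s - a‖ < δ} := fun a =>
    isOpen_interior.inter (isOpen_lt (f.continuous.sub continuous_const).norm continuous_const)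
  obtain ⟨t, htD, ht, hcov⟩ := f.isCompact_tsupport.elim_finite_subcover_image
    (fun a _ => hopen a) hcov
  lift t to Finset A using ht
  -- A partition of unity on the support of `f`, subordinate to the sets where `f` is `δ`-close to
  -- one of finitely many `a` in `D`; the approximant is the sum of the `φ a • a`.
  obtain ⟨φ, hφ1, hφ2⟩ := PartitionOfUnity.exists_isSubordinate_of_locallyFinite_t2space
    f.isCompact_tsupport (fun a : t => {s | s ∈ interior K' ∧ ‖f s - a‖ < δ})
    (fun a => hopen a) (locallyFinite_of_finite _) (by rwa [Set.iUnion_subtype])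
  have hφU : ∀ (a : t) s, φ a s ≠ 0 → s ∈ interior K' ∧ ‖f s - a‖ < δ := fun a s hs =>
    hφ1 a (subset_tsupport _ hs)
  let g : ConvAlg α μ := ∑ a : t, tensor (φ a) (hφ2 a) a
  refine ⟨g, sum_mem fun a _ => hN _ _ _ (htD a.2), ?_⟩
  have hval : ∀ s, (f - g) s = f s - ∑ a : t, (φ a s : ℂ) • (a : A) := fun s => by
    rw [sub_apply, sum_apply]; rfl
  have hle : ∀ s, ‖(f - g) s‖ ≤ δ := fun s => by
    -- The functions `φ a` sum to `1` only on the support of `f`; elsewhere both sides are `0`.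
    have h1 : f s = ∑ a : t, (φ a s : ℂ) • f s := by
      by_cases hs : s ∈ tsupport f
      · have := φ.sum_eq_one hs
        rw [finsum_eq_sum_of_fintype] at this
        rw [← Finset.sum_smul, ← Complex.ofReal_sum, this, Complex.ofReal_one, one_smul]
      · simp [eq_zero_of_notMem hs]
    rw [hval]
    nth_rw 1 [h1]
    rw [← Finset.sum_sub_distrib]
    calc _ ≤ ∑ a : t, φ a s * δ := norm_sum_le_of_le _ fun a _ => by
          rw [← smul_sub, norm_smul, Complex.norm_real, Real.norm_of_nonneg (φ.nonneg a s)]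
          rcases eq_or_ne (φ a s) 0 with h0 | h0
          · simp [h0]
          · exact mul_le_mul_of_nonneg_left (hφU a s h0).2.le (φ.nonneg a s)
      _ ≤ 1 * δ := by
          rw [← Finset.sum_mul]
          have := φ.sum_le_one s
          rw [finsum_eq_sum_of_fintype] at this
          exact mul_le_mul_of_nonneg_right this hδ0.le
      _ = δ := one_mul δ
  have hzero : ∀ s, s ∉ K' → ‖(f - g) s‖ = 0 := fun s hs => by
    rw [hval, eq_zero_of_notMem fun h => hs (interior_subset (hKK' h)), zero_sub, norm_neg,
      norm_eq_zero]
    refine Finset.sum_eq_zero fun a _ => ?_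
    have : φ a s = 0 := by
      by_contra h0
      exact hs (interior_subset (hφU a s h0).1)
    rw [this, Complex.ofReal_zero, zero_smul]
  rw [← setIntegral_eq_integral_of_forall_compl_eq_zero hzero]
  have h1 := norm_setIntegral_le_of_norm_le_const (μ := μ) (s := K') (C := δ)
    (f := fun s => ‖(f - g) s‖) hK'.measure_lt_top
    fun s _ => by rw [norm_norm]; exact hle s
  refine ((le_abs_self _).trans h1).trans_lt ?_
  have h2 : δ * (2 * (μ.real K' + 1)) = ε := by rw [hδ]; field_simp
  nlinarith

end ConvAlg

end Approximation

/-! ### The grading of a completion of `C_c(G, A)` -/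

section Grading

variable {G : Type v} [Group G] [TopologicalSpace G] [IsTopologicalGroup G] [LocallyCompactSpace G]
  [MeasurableSpace G] [BorelSpace G] {A : Type u} [NonUnitalCStarAlgebra A]
  {α : CStarAction G A} {μ : Measure G} [μ.IsHaarMeasure]

/-- The inclusion of `C_c(G, J)` in `C_c(G, A)`. -/
abbrev ConvAlg.incl {J : NonUnitalStarSubalgebra ℂ A} [IsClosed (J : Set A)]
    (hJ : ∀ g, ∀ a ∈ J, α g a ∈ J) : ConvAlg (α.restrict J hJ) μ →⋆ₙₐ[ℂ] ConvAlg α μ :=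
  ConvAlg.map μ (NonUnitalStarSubalgebraClass.subtype J) fun _ _ => rfl

theorem ConvAlg.exists_incl_eq {J : NonUnitalStarSubalgebra ℂ A} [IsClosed (J : Set A)]
    (hJ : ∀ g, ∀ a ∈ J, α g a ∈ J) (f : ConvAlg α μ) (hf : ∀ s, f s ∈ J) :
    ∃ g : ConvAlg (α.restrict J hJ) μ, ConvAlg.incl hJ g = f :=
  ⟨ConvAlg.mk (fun s => ⟨f s, hf s⟩) (f.continuous.subtype_mk hf)
    (HasCompactSupport.intro f.isCompact_tsupport fun _ hs =>
      Subtype.ext (ConvAlg.eq_zero_of_notMem hs)), rfl⟩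

theorem ConvAlg.mul_apply_mem {J : NonUnitalStarSubalgebra ℂ A} (hJ : IsClosed (J : Set A))
    {f g : ConvAlg α μ} (h : ∀ s r, f r * α r (g (r⁻¹ * s)) ∈ J) (s : G) : (f * g) s ∈ J :=
  integral_mem_of_isClosed (p := J.toNonUnitalSubalgebra.toSubmodule) hJ
    (f.continuous_convIntegrand g |>.comp (Continuous.prodMk_right s))
    (HasCompactSupport.intro f.isCompact_tsupport fun _ hr => f.convIntegrand_eq_zero g s hr)
    fun r => h s r

variable {L : Type w} [SemilatticeInf L] {S : L → NonUnitalStarSubalgebra ℂ A}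
  [∀ i, IsClosed (S i : Set A)] {hα : ∀ i g, ∀ a ∈ S i, α g a ∈ S i}
  {p : CStarSeminorm (ConvAlg α μ)}
  {q : ∀ i, CStarSeminorm (ConvAlg (α.restrict (S i) (hα i)) μ)}

/-- Functoriality of `p` lets each equivariant `P i` induce a map of the completion, which is the
identity on the ranges with index above `i` and zero on the others. Both facts hold pointwise on
functions and extend by continuity. -/
theorem independent_range_mapCompletion (hS : IsCStarGrading S)
    (hq : ∀ i f, p.toFun (ConvAlg.incl (hα i) f) ≤ (q i).toFun f)
    (hp : ∀ (P : A →⋆ₙₐ[ℂ] A) (hP : ∀ s a, P (α s a) = α s (P a)) f,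
      p.toFun (ConvAlg.map μ P hP f) ≤ p.toFun f) :
    iSupIndep fun i => (NonUnitalStarAlgHom.range (CStarSeminorm.mapCompletion (q i) p
      (ConvAlg.incl (hα i)) (hq i))).toNonUnitalSubalgebra.toSubmodule := by
  choose P hP1 hP2 _ using hS.exists_hom
  have hPα : ∀ i s a, P i (α s a) = α s (P i a) := fun i s a =>
    hS.hom_equivariant (hP1 i) (hP2 i) (φ := (α s : A →⋆ₙₐ[ℂ] A)) (fun j a ha => hα j s a ha) a
  let Q : L → p.Completion →⋆ₙₐ[ℂ] p.Completion := fun i =>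
    CStarSeminorm.mapCompletion p p (ConvAlg.map μ (P i) (hPα i)) (hp _ _)
  have hQ : ∀ i, Continuous (Q i) := fun i => CStarSeminorm.continuous_mapCompletion _
  have hinc : ∀ j, Continuous (CStarSeminorm.mapCompletion (q j) p (ConvAlg.incl (hα j)) (hq j)) :=
    fun j => CStarSeminorm.continuous_mapCompletion _
  refine iSupIndep_of_projections (fun i => (Q i : p.Completion →+ p.Completion))
    (fun i j hij x hx => ?_) fun i j hij x hx => ?_
  · obtain ⟨y, rfl⟩ := hx
    change Q i (CStarSeminorm.mapCompletion (q j) p (ConvAlg.incl (hα j)) (hq j) y) =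
      CStarSeminorm.mapCompletion (q j) p (ConvAlg.incl (hα j)) (hq j) y
    induction y using UniformSpace.Completion.induction_on with
    | hp => exact isClosed_eq ((hQ i).comp (hinc j)) (hinc j)
    | ih f =>
      rw [CStarSeminorm.mapCompletion_coe, CStarSeminorm.mapCompletion_coe]
      exact congrArg _ (ConvAlg.ext fun s => hP1 i j hij _
        ((show ConvAlg (α.restrict (S j) (hα j)) μ from f) s).2)
  · obtain ⟨y, rfl⟩ := hx
    change Q i (CStarSeminorm.mapCompletion (q j) p (ConvAlg.incl (hα j)) (hq j) y) = 0
    induction y using UniformSpace.Completion.induction_on with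
    | hp => exact isClosed_eq ((hQ i).comp (hinc j)) continuous_const
    | ih f =>
      rw [CStarSeminorm.mapCompletion_coe, CStarSeminorm.mapCompletion_coe,
        ← UniformSpace.Completion.coe_zero]
      exact congrArg _ (ConvAlg.ext fun s => hP2 i j hij _
        ((show ConvAlg (α.restrict (S j) (hα j)) μ from f) s).2)

theorem dense_iSup_range_mapCompletion [T2Space G] (hS : IsCStarGrading S)
    (hq : ∀ i f, p.toFun (ConvAlg.incl (hα i) f) ≤ (q i).toFun f)
    (hp : ∀ f, p.toFun f ≤ ∫ s, ‖f s‖ ∂μ) :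
    Dense ((⨆ i, (NonUnitalStarAlgHom.range (CStarSeminorm.mapCompletion (q i) p
      (ConvAlg.incl (hα i)) (hq i))).toNonUnitalSubalgebra.toSubmodule :
        Submodule ℂ p.Completion) : Set p.Completion) := by
  set M : Submodule ℂ p.Completion := ⨆ i, (NonUnitalStarAlgHom.range
    (CStarSeminorm.mapCompletion (q i) p
      (ConvAlg.incl (hα i)) (hq i))).toNonUnitalSubalgebra.toSubmodule with hM
  -- The functions whose class lies in the algebraic sum of the ranges. It contains the elementary
  -- functions with values in that of the components, so it is L¹-dense, hence dense for `p`.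
  let N : Submodule ℂ (ConvAlg α μ) :=
    M.comap (UniformSpace.Completion.toComplₗᵢ (𝕜 := ℂ) (E := p.Pre)).toLinearMap
  have hN : ∀ (φ : C(G, ℝ)) (hφ : HasCompactSupport φ),
      ∀ a ∈ ((⨆ i, (S i).toNonUnitalSubalgebra.toSubmodule : Submodule ℂ A) : Set A),
      ConvAlg.tensor φ hφ a ∈ N := by
    intro φ hφ a ha
    refine Submodule.iSup_induction _ (motive := fun a => ConvAlg.tensor φ hφ a ∈ N) ha
      (fun i a ha => ?_) ?_ fun a b ha hb => ?_
    · obtain ⟨g, hg⟩ := ConvAlg.exists_incl_eq (hα i) (ConvAlg.tensor (α := α) (μ := μ) φ hφ a)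
        fun s => SMulMemClass.smul_mem _ ha
      rw [← hg]
      refine Submodule.mem_iSup_of_mem i ⟨((show (q i).Pre from g : (q i).Pre) :
        (q i).Completion), ?_⟩
      exact CStarSeminorm.mapCompletion_coe (hq i) g
    · convert zero_mem N
      exact ConvAlg.ext fun s => smul_zero _
    · convert add_mem ha hb
      exact ConvAlg.ext fun s => smul_add _ _ _
  intro z
  induction z using UniformSpace.Completion.induction_on with
  | hp => exact isClosed_closure
  | ih f =>
    refine Metric.mem_closure_iff.2 fun ε hε => ?_
    obtain ⟨g, hg, hfg⟩ := ConvAlg.exists_integral_norm_sub_lt hS.total hN f hε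
    refine ⟨((show p.Pre from g : p.Pre) : p.Completion), hg, ?_⟩
    rw [UniformSpace.Completion.dist_eq, dist_eq_norm]
    exact (hp _).trans_lt hfg

/-- The isometry hypothesis makes the target range closed, so it is enough to multiply functions.
There the integrand `f r * α r (g (r⁻¹ * s))` stays in `S (i ⊓ j)` because the action preserves `S
j`. -/
theorem mul_mem_range_mapCompletion (hS : IsCStarGrading S)
    (hq : ∀ i f, p.toFun (ConvAlg.incl (hα i) f) = (q i).toFun f) (i j : L)
    {x y : p.Completion}
    (hx : x ∈ NonUnitalStarAlgHom.range (CStarSeminorm.mapCompletion (q i) p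
      (ConvAlg.incl (hα i)) fun f => (hq i f).le))
    (hy : y ∈ NonUnitalStarAlgHom.range (CStarSeminorm.mapCompletion (q j) p
      (ConvAlg.incl (hα j)) fun f => (hq j f).le)) :
    x * y ∈ NonUnitalStarAlgHom.range (CStarSeminorm.mapCompletion (q (i ⊓ j)) p
      (ConvAlg.incl (hα (i ⊓ j))) fun f => (hq (i ⊓ j) f).le) := by
  obtain ⟨x, rfl⟩ := hx
  obtain ⟨y, rfl⟩ := hy
  have hcl : IsClosed (Set.range (CStarSeminorm.mapCompletion (q (i ⊓ j)) p
      (ConvAlg.incl (hα (i ⊓ j))) fun f => (hq (i ⊓ j) f).le)) :=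
    (CStarSeminorm.isometry_mapCompletion (hq (i ⊓ j))).isClosedEmbedding.isClosed_range
  change CStarSeminorm.mapCompletion (q i) p (ConvAlg.incl (hα i)) (fun f => (hq i f).le) x *
    CStarSeminorm.mapCompletion (q j) p (ConvAlg.incl (hα j)) (fun f => (hq j f).le) y ∈
      Set.range (CStarSeminorm.mapCompletion (q (i ⊓ j)) p
      (ConvAlg.incl (hα (i ⊓ j))) fun f => (hq (i ⊓ j) f).le)
  induction x, y using UniformSpace.Completion.induction_on₂ with
  | hp =>
    exact hcl.preimage (((CStarSeminorm.continuous_mapCompletion _).comp continuous_fst).mul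
      ((CStarSeminorm.continuous_mapCompletion _).comp continuous_snd))
  | ih f g =>
    let f' : ConvAlg (α.restrict (S i) (hα i)) μ := f
    let g' : ConvAlg (α.restrict (S j) (hα j)) μ := g
    rw [CStarSeminorm.mapCompletion_coe, CStarSeminorm.mapCompletion_coe,
      ← CStarSeminorm.coe_mul]
    obtain ⟨k, hk⟩ := ConvAlg.exists_incl_eq (hα (i ⊓ j))
      (ConvAlg.incl (hα i) f' * ConvAlg.incl (hα j) g')
      (ConvAlg.mul_apply_mem (hS.isClosed _) fun s r =>
        hS.mul_mem i j _ (f' r).2 _ (hα j r _ (g' (r⁻¹ * s)).2))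
    refine ⟨((show (q (i ⊓ j)).Pre from k : (q (i ⊓ j)).Pre) : (q (i ⊓ j)).Completion), ?_⟩
    refine (CStarSeminorm.mapCompletion_coe _ _).trans ?_
    exact congrArg (fun x : p.Pre => (x : p.Completion)) hk

/-- The completion of `C_c(G, A)` for a C⋆-seminorm `p` dominated by the norm of `L¹`, functorial for
equivariant endomorphisms, and restricting to `q i` on `C_c(G, S i)`, is graded by the completions
of the `C_c(G, S i)`. -/
theorem injective_and_isCStarGrading_completion [T2Space G] (hS : IsCStarGrading S)
    (hq : ∀ i f, p.toFun (ConvAlg.incl (hα i) f) = (q i).toFun f)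
    (hp : ∀ f, p.toFun f ≤ ∫ s, ‖f s‖ ∂μ)
    (hpP : ∀ (P : A →⋆ₙₐ[ℂ] A) (hP : ∀ s a, P (α s a) = α s (P a)) f,
      p.toFun (ConvAlg.map μ P hP f) ≤ p.toFun f) :
    (∀ i, Injective (CStarSeminorm.mapCompletion (q i) p (ConvAlg.incl (hα i))
      fun f => (hq i f).le)) ∧
    IsCStarGrading fun i => NonUnitalStarAlgHom.range (CStarSeminorm.mapCompletion (q i) p
      (ConvAlg.incl (hα i)) fun f => (hq i f).le) :=
  ⟨fun i => (CStarSeminorm.isometry_mapCompletion (hq i)).injective,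
    { isClosed := fun i =>
        (CStarSeminorm.isometry_mapCompletion (hq i)).isClosedEmbedding.isClosed_range
      independent := independent_range_mapCompletion hS _ hpP
      total := dense_iSup_range_mapCompletion hS _ hp
      mul_mem := fun i j _ hx _ hy => mul_mem_range_mapCompletion hS hq i j hx hy }⟩

end Grading

end CrossedProduct

end

theorem proposition4p2p1
    {L : Type*} [SemilatticeInf L]
    {A : Type*} [NonUnitalCStarAlgebra A]
    (S : L → NonUnitalStarSubalgebra ℂ A) [∀ i, IsClosed (S i : Set A)]
    (hS : CrossedProduct.IsCStarGrading S)
    {G : Type*} [Group G] [TopologicalSpace G] [IsTopologicalGroup G] [LocallyCompactSpace G]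
    [T2Space G] [MeasurableSpace G] [BorelSpace G]
    (μ : MeasureTheory.Measure G) [μ.IsHaarMeasure] [μ.InnerRegularCompactLTTop]
    (α : CrossedProduct.CStarAction G A) (hα : ∀ i g, ∀ a ∈ S i, α g a ∈ S i) :
    ((∀ i, Function.Injective
        (CrossedProduct.FullCrossedProduct.inclusion α μ (S i) (hα i))) ∧
      CrossedProduct.IsCStarGrading fun i =>
        NonUnitalStarAlgHom.range
          (CrossedProduct.FullCrossedProduct.inclusion α μ (S i) (hα i))) ∧
    ((∀ i, Function.Injective
        (CrossedProduct.ReducedCrossedProduct.inclusion α μ (S i) (hα i))) ∧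
      CrossedProduct.IsCStarGrading fun i =>
        NonUnitalStarAlgHom.range
          (CrossedProduct.ReducedCrossedProduct.inclusion α μ (S i) (hα i))) := by
  choose P hP1 hP2 hP3 using hS.exists_hom
  have hPα : ∀ i s a, P i (α s a) = α s (P i a) := fun i s a =>
    hS.hom_equivariant (hP1 i) (hP2 i) (φ := (α s : A →⋆ₙₐ[ℂ] A)) (fun j a ha => hα j s a ha) a
  -- The two crossed products differ only in the norm comparison: the full one needs `P i`
  -- equivariant there, the reduced one does not.
  exact ⟨CrossedProduct.injective_and_isCStarGrading_completion (hα := hα) hS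
      (fun i f => CrossedProduct.fullNorm_inclusion μ (hα i) (hP3 i) (hP1 i i le_rfl) (hPα i) f)
      (CrossedProduct.fullNorm_le μ) (CrossedProduct.fullNorm_map_le μ),
    CrossedProduct.injective_and_isCStarGrading_completion (hα := hα) hS
      (fun i f => CrossedProduct.reducedNorm_inclusion μ (hα i) (hP3 i) (hP1 i i le_rfl) f)
      (CrossedProduct.reducedNorm_le μ) (CrossedProduct.reducedNorm_map_le μ)⟩
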